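/- Let $0<\alpha\le 1$. For a square real matrix $M$ put $E_{\alpha,\alpha}(M)=\sum_{k\ge 0} M^k/\Gamma(\alpha k+\alpha)$, let $\boldsymbol e$ denote a column vector of ones, and let $$T=\begin{pmatrix}T_{11}&T_{12}&T_{13}\\0&T_{22}&0\\0&0&T_{33}\end{pmatrix},\qquad R=\begin{pmatrix}\boldsymbol e&\boldsymbol e\\ \boldsymbol e&\boldsymbol 0\\ \boldsymbol 0&\boldsymbol e\end{pmatrix},\qquad \pi=(\pi_1,\pi_2,\pi_3),$$ where $\pi_i$ is a row vector of length $p_i$ and $T_{ij}$ is a $p_i\times p_j$ matrix. Assume that $\pi\ge 0$ with $\pi\boldsymbol e\le 1$, and that $T$ is a nonsingular sub-intensity matrix (nonnegative off-diagonal entries and $t:=-T\boldsymbol e\ge 0$); write $t=(t_1,t_2,t_3)$ for the blocks of $t$. Let $Y=(Y_1,Y_2)$ have the distribution $\mathrm{MPH}^*_\alpha(\pi,T,R)$. This is the joint law of the total rewards $Y_k=\int_0^\tau\sum_i r_{ik}1\{X_s=i\}\,ds$, where $X$ is the semi-Markov process with initial distribution $\pi$ on the transient states (the mass $1-\pi\boldsymbol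 e$ being put on the absorbing state), jump probabilities $t_{ij}/(-t_{ii})$ to the states $j\ne i$ and $t_i/(-t_{ii})$ to the absorbing state, and sojourn times in the transient states $i$ that are independent of each other and of the embedded chain and have the density $\lambda_i x^{\alpha-1}E_{\alpha,\alpha}(-\lambda_i x^\alpha)$, $x>0$, with $\lambda_i=-t_{ii}$, and where $\tau$ is its absorption time. It is characterized as the probability law on $[0,\infty)^2$ with Laplace transform $$\mathbb E\,e^{-\langle Y,\theta\rangle}=1-\pi\boldsymbol e+\pi\bigl(\Delta(R\theta)^\alpha-T\bigr)^{-1}t,\qquad \theta\ge 0,$$ where $\Delta(R\theta)^\alpha$ is the diagonal matrix with the entries $(R\theta)_i^\alpha$. Then, under either description of this law, the law of $Y$ is the sum of the following parts, all of whose densities are nonnegative: 1. on $\{0<y<x\}$, the density with respect to Lebesgue measure $dx\,dy$ $$\pi_1\,y^{\alpha-1}E_{\alpha,\alpha}(T_{11}y^\alpha)\,T_{12}\,(x-y)^{\alpha-1}E_{\alpha,\alpha}(T_{22}(x-y)^\alpha)\,t_2;$$ 2. on $\{0<x<y\}$, the density with respect to Lebesgue measure $dx\,dy$ $$\pi_1\,x^{\alpha-1}E_{\alpha,\alpha}(T_{11}x^\alpha)\,T_{13}\,(y-x)^{\alpha-1}E_{\alpha,\alpha}(T_{33}(y-x)^\alpha)\,t_3;$$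 3. on the diagonal $\{(x,x):x>0\}$, the density $x^{\alpha-1}\pi_1E_{\alpha,\alpha}(T_{11}x^\alpha)t_1$ with respect to $dx$; 4. on the axis $\{(x,0):x>0\}$, the density $x^{\alpha-1}\pi_2E_{\alpha,\alpha}(T_{22}x^\alpha)t_2$ with respect to $dx$; 5. on the axis $\{(0,y):y>0\}$, the density $y^{\alpha-1}\pi_3E_{\alpha,\alpha}(T_{33}y^\alpha)t_3$ with respect to $dy$; 6. an atom of mass $1-\pi\boldsymbol e$ at the origin, which is absent when $\pi\boldsymbol e=1$. -/

import Mathlib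

open MeasureTheory ProbabilityTheory Matrix

namespace MPHalpha

noncomputable section

/-- The two-parameter Mittag-Leffler function `E_{α,β}(a) = ∑ₖ aᵏ / Γ(α k + β)`, for `a` in a
topological real algebra; it is used for real numbers and for square real matrices. -/
def mittagLeffler {A : Type*} [Ring A] [Algebra ℝ A] [TopologicalSpace A] (α β : ℝ) (a : A) : A :=
  ∑' k : ℕ, (Real.Gamma (α * k + β))⁻¹ • a ^ k

/-- The Mittag-Leffler distribution `ML(α, l)`, with density `l x^{α-1} E_{α,α}(-l x^α)`, `x > 0`. -/
def mlDistribution (α l : ℝ) : Measure ℝ :=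
  (volume.restrict (Set.Ioi 0)).withDensity fun x =>
    ENNReal.ofReal (l * x ^ (α - 1) * mittagLeffler α α (-l * x ^ α))

/-- The matrix Mittag-Leffler kernel `x^{α-1} E_{α,α}(T x^α)`. -/
def mlKernel {S : Type*} [Fintype S] [DecidableEq S] (α : ℝ) (T : Matrix S S ℝ) (x : ℝ) :
    Matrix S S ℝ :=
  x ^ (α - 1) • mittagLeffler α α (x ^ α • T)

/-- The vector `t = -T e` of exit rates. -/
def exitVector {S : Type*} [Fintype S] (T : Matrix S S ℝ) : S → ℝ :=
  -(T *ᵥ 1)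

/-- `(π, T)` are parameters of a (fractional) phase-type distribution: `π ≥ 0` with total mass at
most one (the missing mass is the probability of starting in the absorbing state), and `T` is a
sub-intensity matrix. All states being transient is expressed by `T` being nonsingular. -/
structure IsPHParam {S : Type*} [Fintype S] [DecidableEq S] (π : S → ℝ) (T : Matrix S S ℝ) :
    Prop where
  init_nonneg : ∀ i, 0 ≤ π i
  init_sum_le : ∑ i, π i ≤ 1
  offDiag_nonneg : ∀ i j, i ≠ j → 0 ≤ T i j
  exit_nonneg : ∀ i, 0 ≤ exitVector T i
  det_ne_zero : T.det ≠ 0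

/-! ### The semi-Markov reward construction

The state space is `Option S`, where `none` is the absorbing state. -/

/-- The initial distribution on `Option S`. -/
def initial {S : Type*} [Fintype S] (π : S → ℝ) : Option S → ℝ
  | some i => π i
  | none => 1 - ∑ i, π i

/-- The transition probabilities of the embedded chain: `q_{ij} = t_{ij} / λ_i` for `j ≠ i`, and
`t_i / λ_i` for absorption, with `λ_i = -t_{ii}`. -/
def embedded {S : Type*} [Fintype S] [DecidableEq S] (T : Matrix S S ℝ) :
    Option S → Option S → ℝ
  | some i, some j => if i = j then 0 else T i j / (-T i i)
  | some i, none => exitVector T i / (-T i i)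
  | none, some _ => 0
  | none, none => 1

/-- `Z` is the embedded Markov chain, started from `π`, and `H n i` is the length of the `n`-th
sojourn if it is spent in the state `i`; these are `ML(α, λ_i)`-distributed, mutually independent,
and independent of the chain. -/
structure IsSemiMarkovModel {S : Type*} [Fintype S] [DecidableEq S] (α : ℝ) (π : S → ℝ)
    (T : Matrix S S ℝ) {Ω : Type*} [MeasurableSpace Ω] (P : Measure Ω)
    (Z : ℕ → Ω → Option S) (H : ℕ → S → Ω → ℝ) : Prop where
  isProbabilityMeasure : IsProbabilityMeasure P
  measurable_chain : ∀ n, Measurable[_, ⊤] (Z n)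
  measurable_sojourn : ∀ n i, Measurable (H n i)
  markov : ∀ (n : ℕ) (z : ℕ → Option S), P.real {ω | ∀ m ≤ n, Z m ω = z m} =
    initial π (z 0) * ∏ m ∈ Finset.range n, embedded T (z m) (z (m + 1))
  sojourn_law : ∀ n i, HasLaw (H n i) (mlDistribution α (-T i i)) P
  sojourn_indep : iIndepFun (fun q : ℕ × S => H q.1 q.2) P
  chain_indep : Indep (⨆ n, MeasurableSpace.comap (Z n) ⊤)
    (⨆ q : ℕ × S, MeasurableSpace.comap (H q.1 q.2) inferInstance) P

/-- The time `S_n` of the `n`-th jump. From absorption on, `S_n` stays equal to the absorption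
time. -/
def jumpTime {S Ω : Type*} (Z : ℕ → Ω → Option S) (H : ℕ → S → Ω → ℝ) (n : ℕ) (ω : Ω) : ℝ :=
  ∑ m ∈ Finset.range n, (Z m ω).elim 0 fun i => H m i ω

open Classical in
/-- The semi-Markov process `X_t`: it equals `Z n` for `S_n ≤ t < S_{n+1}`, and is in the absorbing
state `none` once no sojourn in a transient state covers `t`. -/
def semiMarkov {S Ω : Type*} (Z : ℕ → Ω → Option S) (H : ℕ → S → Ω → ℝ) (t : ℝ) (ω : Ω) :
    Option S :=
  if h : ∃ n, jumpTime Z H n ω ≤ t ∧ t < jumpTime Z H (n + 1) ω then Z (Nat.find h) ω else none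

/-- The absorption time `τ = inf {t ≥ 0 | X_t is absorbed}`. -/
def absorptionTime {S Ω : Type*} (Z : ℕ → Ω → Option S) (H : ℕ → S → Ω → ℝ) (ω : Ω) : ℝ :=
  sInf {t : ℝ | 0 ≤ t ∧ semiMarkov Z H t ω = none}

open Classical in
/-- The vector of total rewards `Y_k = ∫_0^τ ∑_i r_{ik} 1{X_t = i} dt`. -/
def totalReward {S Ω : Type*} [Fintype S] {n : ℕ} (R : Matrix S (Fin n) ℝ)
    (Z : ℕ → Ω → Option S) (H : ℕ → S → Ω → ℝ) (ω : Ω) : Fin n → ℝ := fun k =>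
  ∫ t in (0 : ℝ)..absorptionTime Z H ω,
    ∑ i, R i k * (if semiMarkov Z H t ω = some i then 1 else 0)

/-! ### The Laplace transform of the class `MPH*_α` -/

/-- `μ` is the distribution `MPH*_α(π, T, R)`: the probability measure on the orthant `[0,∞)ⁿ` with
Laplace transform `π (Δ(Rθ)^α - T)⁻¹ t`, `θ ≥ 0`, where the missing initial mass `1 - π e` (which is
zero if `π` is a probability vector) gives an atom at the origin. -/
structure IsMPH {S : Type*} [Fintype S] [DecidableEq S] {n : ℕ} (α : ℝ) (π : S → ℝ)
    (T : Matrix S S ℝ) (R : Matrix S (Fin n) ℝ) (μ : Measure (Fin n → ℝ)) : Prop where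
  isProbabilityMeasure : IsProbabilityMeasure μ
  nonneg : ∀ᵐ y ∂μ, ∀ k, 0 ≤ y k
  laplace : ∀ θ : Fin n → ℝ, (∀ k, 0 ≤ θ k) →
    ∫ y, Real.exp (-(y ⬝ᵥ θ)) ∂μ =
      (1 - ∑ i, π i) +
        π ⬝ᵥ ((diagonal (fun i => (R *ᵥ θ) i ^ α) - T)⁻¹ *ᵥ exitVector T)

/-! ### The two-dimensional example -/

section Example

variable {p₁ p₂ p₃ : ℕ}

/-- The initial vector `(π₁, π₂, π₃)`. -/
def blockInit (π₁ : Fin p₁ → ℝ) (π₂ : Fin p₂ → ℝ) (π₃ : Fin p₃ → ℝ) :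
    Fin p₁ ⊕ (Fin p₂ ⊕ Fin p₃) → ℝ :=
  Sum.elim π₁ (Sum.elim π₂ π₃)

/-- The matrix with block rows `(T₁₁, T₁₂, T₁₃)`, `(0, T₂₂, 0)`, `(0, 0, T₃₃)`. -/
def blockT (T₁₁ : Matrix (Fin p₁) (Fin p₁) ℝ) (T₁₂ : Matrix (Fin p₁) (Fin p₂) ℝ)
    (T₁₃ : Matrix (Fin p₁) (Fin p₃) ℝ) (T₂₂ : Matrix (Fin p₂) (Fin p₂) ℝ)
    (T₃₃ : Matrix (Fin p₃) (Fin p₃) ℝ) :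
    Matrix (Fin p₁ ⊕ (Fin p₂ ⊕ Fin p₃)) (Fin p₁ ⊕ (Fin p₂ ⊕ Fin p₃)) ℝ :=
  fromBlocks T₁₁ (fromCols T₁₂ T₁₃) 0 (fromBlocks T₂₂ 0 0 T₃₃)

/-- The reward matrix with block rows `(e, e)`, `(e, 0)`, `(0, e)`. -/
def blockR (p₁ p₂ p₃ : ℕ) : Matrix (Fin p₁ ⊕ (Fin p₂ ⊕ Fin p₃)) (Fin 2) ℝ :=
  of (Sum.elim (fun _ => ![1, 1]) (Sum.elim (fun _ => ![1, 0]) (fun _ => ![0, 1])))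

/-- The Mittag-Leffler density `π x^{α-1} E_{α,α}(T x^α) t` on `(0, ∞)`. -/
def lineDensity {p : ℕ} (α : ℝ) (π : Fin p → ℝ) (T : Matrix (Fin p) (Fin p) ℝ)
    (t : Fin p → ℝ) (x : ℝ) : ℝ :=
  π ⬝ᵥ (mlKernel α T x *ᵥ t)

/-- The function `π u^{α-1} E_{α,α}(T u^α) D v^{α-1} E_{α,α}(T' v^α) t` of `u, v > 0`. -/
def planeDensity {p q : ℕ} (α : ℝ) (π : Fin p → ℝ) (T : Matrix (Fin p) (Fin p) ℝ)
    (D : Matrix (Fin p) (Fin q) ℝ) (T' : Matrix (Fin q) (Fin q) ℝ) (t : Fin q → ℝ)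
    (u v : ℝ) : ℝ :=
  π ⬝ᵥ ((mlKernel α T u * D * mlKernel α T' v) *ᵥ t)

/-- The measure on the plane composed of a density `f₁` (in `(x, y)`) with respect to Lebesgue
measure on `{0 < y < x}`, a density `f₂` on `{0 < x < y}`, a density `g` on the diagonal
`{(x, x) | x > 0}`, a density `h₁` on the axis `{(x, 0) | x > 0}`, a density `h₂` on the axis
`{(0, y) | y > 0}` (the last three with respect to the Lebesgue measure `dx` or `dy` of the
coordinate), and an atom of mass `c` at the origin. -/
def piecewiseMeasure (f₁ f₂ : ℝ → ℝ → ℝ) (g h₁ h₂ : ℝ → ℝ) (c : ℝ) : Measure (Fin 2 → ℝ) :=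
  (volume.restrict {z : Fin 2 → ℝ | 0 < z 1 ∧ z 1 < z 0}).withDensity
      (fun z => ENNReal.ofReal (f₁ (z 0) (z 1))) +
  (volume.restrict {z : Fin 2 → ℝ | 0 < z 0 ∧ z 0 < z 1}).withDensity
      (fun z => ENNReal.ofReal (f₂ (z 0) (z 1))) +
  ((volume.restrict (Set.Ioi 0)).withDensity (fun x => ENNReal.ofReal (g x))).map
      (fun x : ℝ => (![x, x] : Fin 2 → ℝ)) +
  ((volume.restrict (Set.Ioi 0)).withDensity (fun x => ENNReal.ofReal (h₁ x))).map
      (fun x : ℝ => (![x, 0] : Fin 2 → ℝ)) +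
  ((volume.restrict (Set.Ioi 0)).withDensity (fun y => ENNReal.ofReal (h₂ y))).map
      (fun y : ℝ => (![0, y] : Fin 2 → ℝ)) +
  ENNReal.ofReal c • Measure.dirac 0

/-- `μ` is the measure composed of the given piecewise density and atom, all of which are
nonnegative where they are used (so that no value is truncated in `piecewiseMeasure`). -/
structure HasPiecewiseDensity (μ : Measure (Fin 2 → ℝ)) (f₁ f₂ : ℝ → ℝ → ℝ) (g h₁ h₂ : ℝ → ℝ)
    (c : ℝ) : Prop where
  nonneg_lower : ∀ x y, 0 < y → y < x → 0 ≤ f₁ x y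
  nonneg_upper : ∀ x y, 0 < x → x < y → 0 ≤ f₂ x y
  nonneg_diag : ∀ x, 0 < x → 0 ≤ g x
  nonneg_axis₁ : ∀ x, 0 < x → 0 ≤ h₁ x
  nonneg_axis₂ : ∀ y, 0 < y → 0 ≤ h₂ y
  nonneg_atom : 0 ≤ c
  eq_measure : μ = piecewiseMeasure f₁ f₂ g h₁ h₂ c

/-- The explicit form of the distribution, for `α`, `(π₁, π₂, π₃)` and the block matrix `T`. -/
def HasExplicitForm (α : ℝ) (π₁ : Fin p₁ → ℝ) (π₂ : Fin p₂ → ℝ) (π₃ : Fin p₃ → ℝ)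
    (T₁₁ : Matrix (Fin p₁) (Fin p₁) ℝ) (T₁₂ : Matrix (Fin p₁) (Fin p₂) ℝ)
    (T₁₃ : Matrix (Fin p₁) (Fin p₃) ℝ) (T₂₂ : Matrix (Fin p₂) (Fin p₂) ℝ)
    (T₃₃ : Matrix (Fin p₃) (Fin p₃) ℝ) (μ : Measure (Fin 2 → ℝ)) : Prop :=
  let t := exitVector (blockT T₁₁ T₁₂ T₁₃ T₂₂ T₃₃)
  let t₁ : Fin p₁ → ℝ := fun i => t (Sum.inl i)
  let t₂ : Fin p₂ → ℝ := fun i => t (Sum.inr (Sum.inl i))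
  let t₃ : Fin p₃ → ℝ := fun i => t (Sum.inr (Sum.inr i))
  HasPiecewiseDensity μ
    (fun x y => planeDensity α π₁ T₁₁ T₁₂ T₂₂ t₂ y (x - y))
    (fun x y => planeDensity α π₁ T₁₁ T₁₃ T₃₃ t₃ x (y - x))
    (lineDensity α π₁ T₁₁ t₁)
    (lineDensity α π₂ T₂₂ t₂)
    (lineDensity α π₃ T₃₃ t₃)
    (1 - ∑ i, blockInit π₁ π₂ π₃ i)

end Example

end

end MPHalpha

/-! Both descriptions of the law lead to the same Laplace transform at every θ with positive
coordinates, and a measure on the quadrant is determined by a finite Laplace transform there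
(`measure_ext_of_laplace`). It thus remains to show that the explicit measure has this transform.
The vector Rθ is constant on each block, with the values θ₀ + θ₁, θ₀ and θ₁, so the block triangular
system is solved by back substitution with the resolvents (s^α - Tᵢᵢ)⁻¹. These are the Laplace
transforms of the kernels x^(α-1) E(Tᵢᵢ x^α), and the products of two of them become the planar
parts after the change of variables u = min(x, y), v = |x - y|.

The analytic core is the nonnegativity of the kernel, without which the truncation in
`piecewiseMeasure` would change the measure. Let K(s) be its Laplace transform. For large s a
Neumann series gives (s^α - T) K(s) = 1, and K(s) ≥ 0 by a minimum principle. Differentiation gives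
-K' = α s^(α-1) K². Since α ≤ 1, the factor s^(α-1) is completely monotone, so by induction K is
completely monotone as well. A Post–Widder argument (`nonneg_of_alternatingDeriv`) then returns
nonnegativity of the kernel. The same method bounds its row sums by x^(α-1)/Γ(α), which makes K
finite for all s > 0; analyticity carries the resolvent identity from large s to all s > 0.

For the semi-Markov process, the candidate x = (Δ(Rθ)^α - T)⁻¹ t, extended by 1 to the absorbing
state, is harmonic for the embedded chain weighted by the Laplace transforms of the sojourns. Hence
the expectation of the product of the weights with x(Zₙ) does not depend on n (`integral_step`). The
chain is absorbed almost surely (`eventually_absorbed`), and dominated convergence identifies the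
transform of the total reward (`integral_exp_neg_totalReward`). -/

namespace MPHalpha

/-! ### The Mittag-Leffler series, and the Laplace transform of the kernel for large arguments. -/

section Series

/-- Only the part of the Gamma integral over (M, M + 1] is kept, where the integrand is at least M^a
e^(-(M+1))/(M+1). As M is arbitrary, Γ outgrows every exponential, so all the series below converge.
-/
lemma inv_gamma_le {M a : ℝ} (hM : 0 < M) (ha : 0 < a) :
    (Real.Gamma a)⁻¹ ≤ (M + 1) * Real.exp (M + 1) * (M ^ a)⁻¹ := by
  have key : M ^ a * Real.exp (-(M + 1)) * (M + 1)⁻¹ ≤ Real.Gamma a := by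
    rw [Real.Gamma_eq_integral ha]
    have h1 : ∫ x in Set.Ioc M (M + 1), M ^ a * Real.exp (-(M + 1)) * (M + 1)⁻¹ ≤
        ∫ x in Set.Ioc M (M + 1), Real.exp (-x) * x ^ (a - 1) := by
      refine setIntegral_mono_on (integrableOn_const (by simp))
        ((Real.GammaIntegral_convergent ha).mono_set fun x hx => hM.trans hx.1)
        measurableSet_Ioc fun x hx => ?_
      have hx0 : 0 < x := hM.trans hx.1
      rw [Real.rpow_sub_one hx0.ne', mul_comm (M ^ a), mul_assoc, ← div_eq_mul_inv]
      have := hx.1.le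
      have := hx.2
      gcongr
    refine le_trans ?_ (h1.trans (setIntegral_mono_set (Real.GammaIntegral_convergent ha) ?_ ?_))
    · simp
    · filter_upwards [ae_restrict_mem measurableSet_Ioi] with x hx
      have : (0 : ℝ) < x := hx
      simp only [Pi.zero_apply]
      positivity
    · exact (Filter.Eventually.of_forall fun x hx => hM.trans hx.1)
  have hMa := Real.rpow_pos_of_pos hM a
  have hG := Real.Gamma_pos_of_pos ha
  rw [inv_le_comm₀ hG (by positivity)]
  refine le_trans (le_of_eq ?_) key
  rw [Real.exp_neg]
  field_simp

lemma summable_inv_gamma_mul_pow {α : ℝ} (hα : 0 < α) (c : ℝ) :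
    Summable fun k : ℕ => (Real.Gamma (α * k + α))⁻¹ * c ^ k := by
  refine Summable.of_norm ?_
  -- Any b > |c| would do: with M = b^(1/α) the bound on 1/Γ(αk + α) decays like b^(-k), which
  -- leaves a geometric series of ratio |c|/b.
  set b : ℝ := 2 * |c| + 1
  have hb : 0 < b := by positivity
  set M : ℝ := b ^ α⁻¹
  have hM : 0 < M := Real.rpow_pos_of_pos hb _
  have hs : Summable fun k : ℕ => (M + 1) * Real.exp (M + 1) * b⁻¹ * (|c| / b) ^ k := by
    refine (summable_geometric_of_lt_one (by positivity) ?_).mul_left _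
    rw [div_lt_one hb]
    have := abs_nonneg c
    simp only [b]; linarith
  refine hs.of_nonneg_of_le (fun k => norm_nonneg _) fun k => ?_
  have ha : 0 < α * k + α := by positivity
  have hG := Real.Gamma_pos_of_pos ha
  have hMa : M ^ (α * k + α) = b ^ k * b := by
    rw [← Real.rpow_mul hb.le, ← pow_succ, ← Real.rpow_natCast]
    congr 1
    push_cast
    field_simp
  rw [norm_mul, norm_pow, Real.norm_eq_abs, Real.norm_eq_abs, abs_of_pos (inv_pos.2 hG)]
  calc (Real.Gamma (α * k + α))⁻¹ * |c| ^ k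
      ≤ ((M + 1) * Real.exp (M + 1) * (M ^ (α * k + α))⁻¹) * |c| ^ k := by
        gcongr
        exact inv_gamma_le hM ha
    _ = _ := by rw [hMa, div_pow]; field_simp

variable {S : Type*} [Fintype S]

/-- The sum of the absolute values of the entries. -/
noncomputable def entrySum (T : Matrix S S ℝ) : ℝ := ∑ i, ∑ j, |T i j|

lemma entrySum_nonneg (T : Matrix S S ℝ) : 0 ≤ entrySum T :=
  Finset.sum_nonneg fun _ _ => Finset.sum_nonneg fun _ _ => abs_nonneg _

variable [DecidableEq S]

/-- The sum of the absolute entries serves as a submultiplicative norm; no norm on matrices has to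
be chosen. -/
lemma abs_pow_apply_le (T : Matrix S S ℝ) (k : ℕ) (i j : S) :
    |(T ^ k) i j| ≤ entrySum T ^ k := by
  induction k generalizing i j with
  | zero => by_cases h : i = j <;> simp [h]
  | succ k ih =>
    rw [pow_succ, Matrix.mul_apply]
    calc |∑ l, (T ^ k) i l * T l j| ≤ ∑ l, |(T ^ k) i l * T l j| := Finset.abs_sum_le_sum_abs _ _
      _ ≤ ∑ l, entrySum T ^ k * |T l j| := by
        gcongr with l
        rw [abs_mul]
        gcongr
        exact ih i l
      _ = entrySum T ^ k * ∑ l, |T l j| := by rw [Finset.mul_sum]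
      _ ≤ entrySum T ^ k * entrySum T := by
        have := entrySum_nonneg T
        gcongr
        exact Finset.sum_le_sum fun l _ =>
          Finset.single_le_sum (f := fun j => |T l j|) (fun _ _ => abs_nonneg _)
            (Finset.mem_univ j)
      _ = _ := (pow_succ _ _).symm

/-- The terms of the series of an entry of the matrix Mittag-Leffler function. -/
lemma summable_mittagLeffler_entry {α : ℝ} (hα : 0 < α) (T : Matrix S S ℝ) (z : ℝ) (i j : S) :
    Summable fun k : ℕ => (Real.Gamma (α * k + α))⁻¹ * (T ^ k) i j * z ^ k := by
  refine Summable.of_norm ((summable_inv_gamma_mul_pow hα (entrySum T * |z|)).of_nonneg_of_le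
    (fun _ => norm_nonneg _) fun k => ?_)
  have hG := Real.Gamma_pos_of_pos (show 0 < α * k + α by positivity)
  rw [norm_mul, norm_mul, norm_pow, Real.norm_eq_abs, Real.norm_eq_abs, Real.norm_eq_abs,
    abs_of_pos (inv_pos.2 hG), mul_pow, mul_assoc]
  gcongr
  exact abs_pow_apply_le T k i j

lemma mittagLeffler_smul_apply {α : ℝ} (hα : 0 < α) (T : Matrix S S ℝ) (z : ℝ) (i j : S) :
    mittagLeffler α α (z • T) i j =
      ∑' k : ℕ, (Real.Gamma (α * k + α))⁻¹ * (T ^ k) i j * z ^ k := by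
  have hs : Summable fun k : ℕ => (Real.Gamma (α * k + α))⁻¹ • (z • T) ^ k := by
    refine Pi.summable.2 fun i => Pi.summable.2 fun j => ?_
    refine (summable_mittagLeffler_entry hα T z i j).congr fun k => ?_
    simp [smul_pow]
    ring
  rw [mittagLeffler]
  have h1 := congrFun (tsum_apply (f := fun k : ℕ =>
    ((Real.Gamma (α * k + α))⁻¹ • (z • T) ^ k : S → S → ℝ)) (x := i) hs) j
  refine h1.trans ((tsum_apply (Pi.summable.1 hs i)).trans ?_)
  refine tsum_congr fun k => ?_
  simp [smul_pow]
  ring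

lemma continuous_mittagLeffler_entry {α : ℝ} (hα : 0 < α) (T : Matrix S S ℝ) (i j : S) :
    Continuous fun z : ℝ => mittagLeffler α α (z • T) i j := by
  simp_rw [mittagLeffler_smul_apply hα]
  rw [continuous_iff_continuousAt]
  intro z₀
  -- The series converges uniformly only on bounded sets, hence the window around `z₀`.
  have hc : ContinuousOn (fun z : ℝ => ∑' k : ℕ, (Real.Gamma (α * k + α))⁻¹ * (T ^ k) i j * z ^ k)
      (Set.Ioo (-(|z₀| + 1)) (|z₀| + 1)) := by
    refine continuousOn_tsum (u := fun k : ℕ =>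
      (Real.Gamma (α * k + α))⁻¹ * (entrySum T * (|z₀| + 1)) ^ k) (fun k => by fun_prop)
      (summable_inv_gamma_mul_pow hα _) fun k z hz => ?_
    have hG := Real.Gamma_pos_of_pos (show 0 < α * k + α by positivity)
    rw [norm_mul, norm_mul, norm_pow, Real.norm_eq_abs, Real.norm_eq_abs, Real.norm_eq_abs,
      abs_of_pos (inv_pos.2 hG), mul_pow, mul_assoc]
    have := entrySum_nonneg T
    gcongr
    · exact abs_pow_apply_le T k i j
    · exact (abs_lt.2 hz).le
  refine hc.continuousAt (Ioo_mem_nhds ?_ ?_)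
  · linarith [neg_abs_le z₀]
  · linarith [le_abs_self z₀]

lemma mlKernel_apply (α : ℝ) (T : Matrix S S ℝ) (x : ℝ) (i j : S) :
    mlKernel α T x i j = x ^ (α - 1) * mittagLeffler α α (x ^ α • T) i j := by
  simp [mlKernel]

lemma measurable_mlKernel_apply {α : ℝ} (hα : 0 < α) (T : Matrix S S ℝ) (i j : S) :
    Measurable fun x => mlKernel α T x i j := by
  simp_rw [mlKernel_apply]
  exact (measurable_id.pow_const _).mul
    ((continuous_mittagLeffler_entry hα T i j).measurable.comp (measurable_id.pow_const _))

lemma continuousOn_mlKernel_apply {α : ℝ} (hα : 0 < α) (T : Matrix S S ℝ) (i j : S) :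
    ContinuousOn (fun x => mlKernel α T x i j) (Set.Ioi 0) := by
  simp_rw [mlKernel_apply]
  refine ContinuousOn.mul ?_ ?_
  · exact continuousOn_id.rpow_const fun x hx => Or.inl (ne_of_gt hx)
  · exact (continuous_mittagLeffler_entry hα T i j).comp_continuousOn
      (continuousOn_id.rpow_const fun x hx => Or.inl (ne_of_gt hx))

/-- The series of an entry of the kernel, multiplied with an exponential. -/
lemma exp_mul_mlKernel_apply {α : ℝ} (hα : 0 < α) (T : Matrix S S ℝ) (s : ℝ) (i j : S) {x : ℝ}
    (hx : 0 < x) :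
    Real.exp (-(s * x)) * mlKernel α T x i j = ∑' k : ℕ,
      (Real.Gamma (α * k + α))⁻¹ * (T ^ k) i j *
        (x ^ (α * k + α - 1) * Real.exp (-(s * x))) := by
  rw [mlKernel_apply, mittagLeffler_smul_apply hα, ← tsum_mul_left, ← tsum_mul_left]
  refine tsum_congr fun k => ?_
  rw [← Real.rpow_mul_natCast hx.le, show α * k + α - 1 = (α - 1) + α * k by ring,
    Real.rpow_add hx]
  ring

lemma integral_rpow_mul_exp {α s : ℝ} (hα : 0 < α) (hs : 0 < s) (k : ℕ) :
    ∫ x in Set.Ioi (0 : ℝ), x ^ (α * k + α - 1) * Real.exp (-(s * x)) =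
      ((s ^ α)⁻¹) ^ (k + 1) * Real.Gamma (α * k + α) := by
  rw [Real.integral_rpow_mul_exp_neg_mul_Ioi (show 0 < α * k + α by positivity) hs]
  congr 1
  rw [one_div, Real.inv_rpow hs.le, inv_pow, ← Real.rpow_mul_natCast hs.le]
  congr 2
  push_cast
  ring

lemma integrableOn_rpow_mul_exp {a s : ℝ} (ha : 0 < a) (hs : 0 < s) :
    IntegrableOn (fun x : ℝ => x ^ (a - 1) * Real.exp (-(s * x))) (Set.Ioi 0) := by
  have := integrableOn_rpow_mul_exp_neg_mul_rpow (s := a - 1) (p := 1) (b := s) (by linarith)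
    one_pos hs
  simpa using this

/-- Termwise integration: the Gamma factors cancel and leave the Neumann series of (s^α - T)⁻¹. The
condition on `entrySum T` makes the integrals of the absolute values geometric with ratio below 1,
which justifies the interchange. -/
lemma mlKernel_laplace_series {α s : ℝ} (hα : 0 < α) (hs : 0 < s) (T : Matrix S S ℝ)
    (hT : entrySum T < s ^ α) (i j : S) :
    IntegrableOn (fun x => Real.exp (-(s * x)) * mlKernel α T x i j) (Set.Ioi 0) ∧
    HasSum (fun k : ℕ => (T ^ k) i j * ((s ^ α)⁻¹) ^ (k + 1))
      (∫ x in Set.Ioi 0, Real.exp (-(s * x)) * mlKernel α T x i j) := by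
  have hsα : 0 < s ^ α := Real.rpow_pos_of_pos hs _
  set F : ℕ → ℝ → ℝ := fun k x => (Real.Gamma (α * k + α))⁻¹ * (T ^ k) i j *
        (x ^ (α * k + α - 1) * Real.exp (-(s * x)))
  have hF : ∀ k, Integrable (F k) (volume.restrict (Set.Ioi 0)) := fun k =>
    (integrableOn_rpow_mul_exp (by positivity) hs).const_mul _
  have hint : ∀ k, ∫ x in Set.Ioi 0, F k x = (T ^ k) i j * ((s ^ α)⁻¹) ^ (k + 1) := fun k => by
    have hG := Real.Gamma_pos_of_pos (show 0 < α * k + α by positivity)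
    simp only [F]
    rw [integral_const_mul, integral_rpow_mul_exp hα hs]
    field_simp
  have hnorm : ∀ k, ∫ x in Set.Ioi 0, ‖F k x‖ = |(T ^ k) i j| * ((s ^ α)⁻¹) ^ (k + 1) := fun k => by
    have hG := Real.Gamma_pos_of_pos (show 0 < α * k + α by positivity)
    have : ∀ x ∈ Set.Ioi (0 : ℝ), ‖F k x‖ = (Real.Gamma (α * k + α))⁻¹ * |(T ^ k) i j| *
        (x ^ (α * k + α - 1) * Real.exp (-(s * x))) := fun x hx => by
      have hx : (0 : ℝ) < x := hx
      simp only [F]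
      rw [norm_mul, norm_mul, Real.norm_eq_abs, Real.norm_eq_abs, Real.norm_eq_abs,
        abs_of_pos (inv_pos.2 hG), abs_of_nonneg (a := x ^ _ * _) (by positivity)]
    rw [setIntegral_congr_fun measurableSet_Ioi this, integral_const_mul,
      integral_rpow_mul_exp hα hs]
    field_simp
  have hsum : Summable fun k => ∫ x in Set.Ioi 0, ‖F k x‖ := by
    simp_rw [hnorm]
    have hg : Summable fun k : ℕ => (s ^ α)⁻¹ * (entrySum T / s ^ α) ^ k :=
      (summable_geometric_of_lt_one (div_nonneg (entrySum_nonneg T) hsα.le)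
        ((div_lt_one hsα).2 hT)).mul_left _
    refine hg.of_nonneg_of_le (fun k => by positivity) fun k => ?_
    calc |(T ^ k) i j| * ((s ^ α)⁻¹) ^ (k + 1) ≤ entrySum T ^ k * ((s ^ α)⁻¹) ^ (k + 1) := by
          gcongr
          exact abs_pow_apply_le T k i j
      _ = _ := by rw [div_pow, pow_succ, inv_pow]; field_simp
  have hE : ∀ x ∈ Set.Ioi (0 : ℝ),
      Real.exp (-(s * x)) * mlKernel α T x i j = ∑' k, F k x := fun x hx =>
    exp_mul_mlKernel_apply hα T s i j hx
  refine ⟨?_, ?_⟩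
  · refine ⟨?_, ?_⟩
    · exact ((by fun_prop : Measurable fun x : ℝ => Real.exp (-(s * x))).mul
        (measurable_mlKernel_apply hα T i j)).aestronglyMeasurable
    · rw [hasFiniteIntegral_iff_enorm]
      have h1 : ∫⁻ x in Set.Ioi 0, ‖Real.exp (-(s * x)) * mlKernel α T x i j‖ₑ ≤
          ∫⁻ x in Set.Ioi 0, ∑' k, ‖F k x‖ₑ := by
        refine setLIntegral_mono' measurableSet_Ioi fun x hx => ?_
        rw [hE x hx]
        exact enorm_tsum_le_tsum_enorm
      refine h1.trans_lt ?_
      rw [lintegral_tsum fun k => (hF k).1.enorm]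
      simp_rw [← ofReal_integral_norm_eq_lintegral_enorm (hF _)]
      rw [← ENNReal.ofReal_tsum_of_nonneg (fun k => integral_nonneg fun _ => norm_nonneg _) hsum]
      exact ENNReal.ofReal_lt_top
  · have := hasSum_integral_of_summable_integral_norm hF hsum
    simp_rw [hint] at this
    rwa [setIntegral_congr_fun measurableSet_Ioi hE]

/-- Multiplying the Neumann series by T gives s^α times that series without its term k = 0, so only
the identity survives in the difference. -/
lemma mlKernel_laplace_resolvent {α s : ℝ} (hα : 0 < α) (hs : 0 < s) (T : Matrix S S ℝ)
    (hT : entrySum T < s ^ α) (i j : S) :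
    s ^ α * (∫ x in Set.Ioi 0, Real.exp (-(s * x)) * mlKernel α T x i j) -
      ∑ l, T i l * (∫ x in Set.Ioi 0, Real.exp (-(s * x)) * mlKernel α T x l j) =
      (1 : Matrix S S ℝ) i j := by
  have hsα : 0 < s ^ α := Real.rpow_pos_of_pos hs _
  have h1 := (mlKernel_laplace_series hα hs T hT i j).2.mul_left (s ^ α)
  have h2 : HasSum (fun k : ℕ => (T ^ (k + 1)) i j * ((s ^ α)⁻¹) ^ (k + 1))
      (∑ l, T i l * (∫ x in Set.Ioi 0, Real.exp (-(s * x)) * mlKernel α T x l j)) := by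
    have := hasSum_sum (s := Finset.univ) fun l _ =>
      (mlKernel_laplace_series hα hs T hT l j).2.mul_left (T i l)
    refine this.congr_fun fun k => ?_
    rw [pow_succ', Matrix.mul_apply, Finset.sum_mul]
    exact Finset.sum_congr rfl fun l _ => (mul_assoc _ _ _)
  have h3 : HasSum (fun k : ℕ => (T ^ k) i j * ((s ^ α)⁻¹) ^ k)
      (s ^ α * (∫ x in Set.Ioi 0, Real.exp (-(s * x)) * mlKernel α T x i j)) := by
    refine h1.congr_fun fun k => ?_
    rw [pow_succ]
    field_simp
  have h4 := (hasSum_nat_add_iff' 1).2 h3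
  simp only [Finset.range_one, Finset.sum_singleton, pow_zero, mul_one] at h4
  have := h4.unique h2
  linarith

end Series

/-! ### Completely monotone functions and inversion of the Laplace transform. -/

section CompletelyMonotone

/-- On `(s₀, ∞)`, the function `f` is nonnegative, and so are the first `n` derivatives of `f` after
multiplication with alternating signs. -/
def AlternatingDeriv (s₀ : ℝ) : ℕ → (ℝ → ℝ) → Prop
  | 0, f => ∀ s > s₀, 0 ≤ f s
  | n + 1, f => (∀ s > s₀, 0 ≤ f s) ∧
      ∃ g : ℝ → ℝ, (∀ s > s₀, HasDerivAt f (-g s) s) ∧ AlternatingDeriv s₀ n g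

namespace AlternatingDeriv

variable {s₀ : ℝ} {n : ℕ} {f g : ℝ → ℝ}

lemma nonneg (hf : AlternatingDeriv s₀ n f) : ∀ s > s₀, 0 ≤ f s := by
  cases n with
  | zero => exact hf
  | succ n => exact hf.1

lemma of_succ (hf : AlternatingDeriv s₀ (n + 1) f) : AlternatingDeriv s₀ n f := by
  induction n generalizing f with
  | zero => exact hf.1
  | succ n ih =>
    obtain ⟨h0, g, hg, hgn⟩ := hf
    exact ⟨h0, g, hg, ih hgn⟩

lemma congr (hf : AlternatingDeriv s₀ n f) (h : ∀ s > s₀, f s = g s) :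
    AlternatingDeriv s₀ n g := by
  cases n with
  | zero => exact fun s hs => h s hs ▸ hf s hs
  | succ n =>
    obtain ⟨h0, f', hf', hn⟩ := hf
    refine ⟨fun s hs => h s hs ▸ h0 s hs, f', fun s hs => (hf' s hs).congr_of_eventuallyEq ?_, hn⟩
    filter_upwards [Ioi_mem_nhds hs] with u hu using (h u hu).symm

lemma add (hf : AlternatingDeriv s₀ n f) (hg : AlternatingDeriv s₀ n g) :
    AlternatingDeriv s₀ n fun s => f s + g s := by
  induction n generalizing f g with
  | zero => exact fun s hs => add_nonneg (hf s hs) (hg s hs)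
  | succ n ih =>
    obtain ⟨h0, f', hf', hn⟩ := hf
    obtain ⟨k0, g', hg', kn⟩ := hg
    refine ⟨fun s hs => add_nonneg (h0 s hs) (k0 s hs), _, fun s hs => ?_, ih hn kn⟩
    exact ((hf' s hs).add (hg' s hs)).congr_deriv (by ring)

/-- The product rule -(fg)' = (-f')g + f(-g') has no negative terms; the undifferentiated factors
are needed to one order less, which `of_succ` provides. -/
lemma mul (hf : AlternatingDeriv s₀ n f) (hg : AlternatingDeriv s₀ n g) :
    AlternatingDeriv s₀ n fun s => f s * g s := by
  induction n generalizing f g with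
  | zero => exact fun s hs => mul_nonneg (hf s hs) (hg s hs)
  | succ n ih =>
    have hf0 := hf.of_succ
    have hg0 := hg.of_succ
    obtain ⟨h0, f', hf', hn⟩ := hf
    obtain ⟨k0, g', hg', kn⟩ := hg
    refine ⟨fun s hs => mul_nonneg (h0 s hs) (k0 s hs), _, fun s hs => ?_,
      (ih hn hg0).add (ih hf0 kn)⟩
    exact ((hf' s hs).mul (hg' s hs)).congr_deriv (by ring)

lemma const {c : ℝ} (hc : 0 ≤ c) : AlternatingDeriv s₀ n fun _ => c := by
  induction n generalizing c with
  | zero => exact fun _ _ => hc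
  | succ n ih =>
    exact ⟨fun _ _ => hc, fun _ => 0, fun s _ => by simpa using hasDerivAt_const s c, ih le_rfl⟩

lemma sum {ι : Type*} (A : Finset ι) {F : ι → ℝ → ℝ} (hF : ∀ i, AlternatingDeriv s₀ n (F i)) :
    AlternatingDeriv s₀ n fun s => ∑ i ∈ A, F i s := by
  classical
  induction A using Finset.induction_on with
  | empty => simpa using const le_rfl
  | insert i A hi ih =>
    simp_rw [Finset.sum_insert hi]
    exact (hF i).add ih

lemma rpow (hs₀ : 0 ≤ s₀) {b : ℝ} (hb : b ≤ 0) : AlternatingDeriv s₀ n fun s => s ^ b := by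
  induction n generalizing b with
  | zero => exact fun s hs => Real.rpow_nonneg (hs₀.trans (le_of_lt hs)) _
  | succ n ih =>
    refine ⟨fun s hs => Real.rpow_nonneg (hs₀.trans (le_of_lt hs)) _, fun s => -b * s ^ (b - 1),
      fun s hs => ?_, (const (neg_nonneg.2 hb)).mul (ih (by linarith))⟩
    exact (Real.hasDerivAt_rpow_const (Or.inl (hs₀.trans_lt hs).ne')).congr_deriv (by ring)

end AlternatingDeriv

/-- The moments of `f` on `(0, ∞)` with an exponential weight, up to sign the derivatives of the
Laplace transform. -/
noncomputable def expMoment (f : ℝ → ℝ) (k : ℕ) (s : ℝ) : ℝ :=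
  ∫ u in Set.Ioi 0, u ^ k * (Real.exp (-(s * u)) * f u)

/-- The gap s - r pays for the power: u^k e^(-(s-r)u) ≤ k!/(s-r)^k, from one term of the exponential
series. -/
lemma integrableOn_pow_mul_exp_mul {f : ℝ → ℝ} {r s : ℝ} (hrs : r < s)
    (hf : IntegrableOn (fun u => Real.exp (-(r * u)) * f u) (Set.Ioi 0)) (k : ℕ) :
    IntegrableOn (fun u => u ^ k * (Real.exp (-(s * u)) * f u)) (Set.Ioi 0) := by
  have h : ∀ u : ℝ, u ^ k * (Real.exp (-(s * u)) * f u) =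
      (u ^ k * Real.exp (-((s - r) * u))) * (Real.exp (-(r * u)) * f u) := fun u => by
    rw [show -(s * u) = -((s - r) * u) + -(r * u) by ring, Real.exp_add]
    ring
  simp_rw [h]
  refine Integrable.bdd_mul (c := (k.factorial : ℝ) / (s - r) ^ k) hf
    (by fun_prop : Measurable fun u : ℝ => u ^ k * Real.exp (-((s - r) * u))).aestronglyMeasurable
    ?_
  filter_upwards [ae_restrict_mem measurableSet_Ioi] with u hu
  have hu : (0 : ℝ) < u := hu
  have hd : 0 < s - r := sub_pos.2 hrs
  have := Real.pow_div_factorial_le_exp (x := (s - r) * u) (by positivity) k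
  rw [Real.norm_of_nonneg (by positivity), Real.exp_neg, ← div_eq_mul_inv, div_le_div_iff₀
    (Real.exp_pos _) (by positivity)]
  rw [div_le_iff₀ (by positivity), mul_pow] at this
  linarith

lemma hasDerivAt_expMoment {f : ℝ → ℝ} {s₀ : ℝ}
    (hf : ∀ s > s₀, IntegrableOn (fun u => Real.exp (-(s * u)) * f u) (Set.Ioi 0)) (k : ℕ)
    {s : ℝ} (hs : s₀ < s) : HasDerivAt (expMoment f k) (-expMoment f (k + 1) s) s := by
  -- On the neighbourhood (r, ∞) of s the derivative is dominated by the integrand at r. The second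
  -- point q < r makes that integrand integrable in spite of its extra power of u.
  obtain ⟨r, hr0, hr⟩ := exists_between hs
  obtain ⟨q, hq0, hq⟩ := exists_between hr0
  have hint : ∀ (t : ℝ), q < t → ∀ k : ℕ,
      IntegrableOn (fun u => u ^ k * (Real.exp (-(t * u)) * f u)) (Set.Ioi 0) := fun t ht k =>
    integrableOn_pow_mul_exp_mul ht (hf q hq0) k
  have key := (hasDerivAt_integral_of_dominated_loc_of_deriv_le (μ := volume.restrict (Set.Ioi 0))
    (F := fun t u => u ^ k * (Real.exp (-(t * u)) * f u))
    (F' := fun t u => -(u ^ (k + 1) * (Real.exp (-(t * u)) * f u)))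
    (bound := fun u => ‖u ^ (k + 1) * (Real.exp (-(r * u)) * f u)‖)
    (x₀ := s) (Ioi_mem_nhds hr) ?_ (hint s (hq.trans hr) k)
    (hint s (hq.trans hr) (k + 1)).neg.1 ?_ (hint r hq (k + 1)).norm ?_).2
  · rw [integral_neg] at key
    exact key
  · filter_upwards [Ioi_mem_nhds (hq.trans hr)] with t ht using (hint t ht k).1
  · filter_upwards [ae_restrict_mem measurableSet_Ioi] with u hu t ht
    have hu : (0 : ℝ) < u := hu
    have ht : r < t := ht
    rw [norm_neg, norm_mul, norm_mul, norm_mul, norm_mul, Real.norm_eq_abs (Real.exp _),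
      Real.norm_eq_abs (Real.exp _), Real.abs_exp, Real.abs_exp]
    gcongr
  · filter_upwards with u t _
    have h1 : HasDerivAt (fun t : ℝ => -(t * u)) (-u) t :=
      ((hasDerivAt_id' t).mul_const u).fun_neg.congr_deriv (by simp)
    exact ((h1.exp.mul_const (f u)).const_mul (u ^ k)).congr_deriv (by ring)

/-- By uniqueness of derivatives, the function witnessing the alternating derivative of one moment
agrees with the next moment; the induction on k keeps all orders n available. -/
lemma expMoment_nonneg {f : ℝ → ℝ} {s₀ : ℝ}
    (hf : ∀ s > s₀, IntegrableOn (fun u => Real.exp (-(s * u)) * f u) (Set.Ioi 0))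
    (h : ∀ n, AlternatingDeriv s₀ n (expMoment f 0)) (k : ℕ) :
    ∀ s > s₀, 0 ≤ expMoment f k s := by
  have : ∀ n, AlternatingDeriv s₀ n (expMoment f k) := by
    induction k with
    | zero => exact h
    | succ k ih =>
      intro n
      obtain ⟨-, g, hg, hn⟩ := ih (n + 1)
      exact hn.congr fun s hs =>
        neg_injective ((hg s hs).unique (hasDerivAt_expMoment hf k hs))
  exact this 0

/-- The function (1 + v)e^(-v) increases up to v = 0 and decreases afterwards, so away from its peak
it is controlled by its values at ±d. The proof compares e^(v ∓ d) with its tangent line at v = ±d.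
-/
lemma one_add_mul_exp_neg_le {d v : ℝ} (hd : 0 < d) (hd1 : d < 1) (hv : d ≤ |v|) :
    (1 + v) * Real.exp (-v) ≤ max ((1 + d) * Real.exp (-d)) ((1 - d) * Real.exp d) := by
  rcases le_abs'.1 hv with h | h
  · refine le_max_of_le_right ?_
    have h1 : 1 + v ≤ (1 - d) * Real.exp (v + d) := by
      have := Real.add_one_le_exp (v + d)
      have h2 : (1 - d) * (v + d + 1) ≤ (1 - d) * Real.exp (v + d) := by gcongr
      nlinarith
    calc (1 + v) * Real.exp (-v) ≤ ((1 - d) * Real.exp (v + d)) * Real.exp (-v) := by gcongr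
      _ = _ := by rw [mul_assoc, ← Real.exp_add]; congr 2; ring
  · refine le_max_of_le_left ?_
    have h1 : 1 + v ≤ (1 + d) * Real.exp (v - d) := by
      have := Real.add_one_le_exp (v - d)
      have h2 : (1 + d) * (v - d + 1) ≤ (1 + d) * Real.exp (v - d) := by gcongr
      nlinarith
    calc (1 + v) * Real.exp (-v) ≤ ((1 + d) * Real.exp (v - d)) * Real.exp (-v) := by gcongr
      _ = _ := by rw [mul_assoc, ← Real.exp_add]; congr 2; ring

lemma one_add_mul_exp_neg_lt_one {v : ℝ} (hv : v ≠ 0) : (1 + v) * Real.exp (-v) < 1 := by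
  have := Real.add_one_lt_exp hv
  rw [Real.exp_neg, ← div_eq_mul_inv, div_lt_one (Real.exp_pos _)]
  linarith

/-- A function whose exponentially weighted moments are all nonnegative is nonnegative. -/
lemma nonneg_of_expMoment_nonneg {f : ℝ → ℝ} {s₀ : ℝ} (hc : ContinuousOn f (Set.Ioi 0))
    (hf : ∀ s > s₀, IntegrableOn (fun u => Real.exp (-(s * u)) * f u) (Set.Ioi 0))
    (h : ∀ k, ∀ s > s₀, 0 ≤ expMoment f k s) {x : ℝ} (hx : 0 < x) : 0 ≤ f x := by
  by_contra! hneg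
  set r := s₀ + 1
  have hr : s₀ < r := by simp [r]
  set g : ℝ → ℝ := fun u => Real.exp (-(r * u)) * f u
  have hgi : IntegrableOn g (Set.Ioi 0) := hf r hr
  have hgc : ContinuousOn g (Set.Ioi 0) := by fun_prop
  have hgx : g x < 0 := mul_neg_of_pos_of_neg (Real.exp_pos _) hneg
  -- This is (u/x) e^(1 - u/x), with maximum 1 at u = x. Its powers are the Post–Widder kernels u^n
  -- e^(-nu/x) up to constants, and they concentrate at x.
  set w : ℝ → ℝ := fun u => (1 + (u / x - 1)) * Real.exp (-(u / x - 1))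
  have hwc : Continuous w := by fun_prop
  have hwx : w x = 1 := by simp [w, hx.ne']
  have hw0 : ∀ u, 0 ≤ u → 0 ≤ w u := fun u hu => by
    have : 0 ≤ u / x := by positivity
    simp only [w]
    have := Real.exp_pos (-(u / x - 1))
    nlinarith
  -- the moments are the integrals of `w ^ n * g`
  have hmom : ∀ n : ℕ, 0 ≤ ∫ u in Set.Ioi 0, w u ^ n * g u := fun n => by
    have h1 := h n (n / x + r) (by have : (0 : ℝ) ≤ n / x := by positivity
                                   linarith)
    have h2 : ∀ u : ℝ, w u ^ n * g u =
        (Real.exp n / x ^ n) * (u ^ n * (Real.exp (-((n / x + r) * u)) * f u)) := fun u => by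
      simp only [w, g]
      rw [add_sub_cancel, mul_pow, div_pow, ← Real.exp_nat_mul,
        show -((n / x + r) * u) = n * -(u / x - 1) + -(r * u) - n by field_simp; ring,
        Real.exp_sub, Real.exp_add]
      have := (Real.exp_pos n).ne'
      field_simp
    simp_rw [h2]
    rw [integral_const_mul]
    exact mul_nonneg (by positivity) h1
  -- a neighbourhood of `x` on which `g` is negative
  obtain ⟨d, hd0, hd1, hd⟩ : ∃ d : ℝ, 0 < d ∧ d < 1 ∧ ∀ u, |u / x - 1| < d → g u < g x / 2 := by
    have h1 : ∀ᶠ u in nhds x, g u < g x / 2 :=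
      ((hgc.continuousAt (Ioi_mem_nhds hx)).eventually_lt_const (by linarith))
    obtain ⟨e, he, h2⟩ := Metric.eventually_nhds_iff.1 h1
    refine ⟨min (e / x) (1 / 2), by positivity, by simp; norm_num, fun u hu => h2 ?_⟩
    have h3 := hu.trans_le (min_le_left _ _)
    rw [Real.dist_eq, show u - x = (u / x - 1) * x by field_simp, abs_mul, abs_of_pos hx]
    exact (lt_div_iff₀ hx).1 h3
  -- The bound q for w outside the neighbourhood where g < g(x)/2 is smaller than 1. Hence a level
  -- q' in (q, 1) is exceeded by w still closer to x, and the negative contribution there, of order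
  -- q'^n, beats the rest, of order q^n.
  set q := max ((1 + d) * Real.exp (-d)) ((1 - d) * Real.exp d)
  have hq0 : 0 < q := lt_max_of_lt_left (by positivity)
  have hq1 : q < 1 := by
    refine max_lt (one_add_mul_exp_neg_lt_one hd0.ne') ?_
    have := one_add_mul_exp_neg_lt_one (neg_ne_zero.2 hd0.ne')
    simpa [sub_eq_add_neg] using this
  have hwq : ∀ u, d ≤ |u / x - 1| → w u ≤ q := fun u hu => one_add_mul_exp_neg_le hd0 hd1 hu
  obtain ⟨q', hqq', hq'1⟩ := exists_between hq1
  obtain ⟨e, he0, hed, he⟩ : ∃ e : ℝ, 0 < e ∧ e < d ∧ ∀ u, |u / x - 1| < e → q' < w u := by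
    have h1 : ∀ᶠ u in nhds x, q' < w u :=
      (hwc.continuousAt.eventually_const_lt (by rw [hwx]; exact hq'1))
    obtain ⟨e, he, h2⟩ := Metric.eventually_nhds_iff.1 h1
    refine ⟨min (e / x) (d / 2), by positivity, (min_le_right _ _).trans_lt (by linarith),
      fun u hu => h2 ?_⟩
    have h3 := hu.trans_le (min_le_left _ _)
    rw [Real.dist_eq, show u - x = (u / x - 1) * x by field_simp, abs_mul, abs_of_pos hx]
    exact (lt_div_iff₀ hx).1 h3
  -- upper bound for the integrals
  set I : Set ℝ := Set.Ioo (x * (1 - e)) (x * (1 + e))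
  have hI : ∀ u ∈ I, |u / x - 1| < e := fun u hu => by
    rw [abs_lt, lt_sub_iff_add_lt, sub_lt_iff_lt_add, lt_div_iff₀ hx, div_lt_iff₀ hx]
    constructor <;> nlinarith [hu.1, hu.2]
  have hIs : I ⊆ Set.Ioi 0 := fun u hu => by
    have : 0 < x * (1 - e) := mul_pos hx (by linarith)
    exact this.trans hu.1
  have hbound : ∀ n : ℕ, ∀ u ∈ Set.Ioi (0 : ℝ),
      w u ^ n * g u ≤ q ^ n * ‖g u‖ + I.indicator (fun _ => q' ^ n * (g x / 2)) u := by
    intro n u hu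
    have hwn : 0 ≤ w u := hw0 u (le_of_lt hu)
    by_cases huI : u ∈ I
    · rw [Set.indicator_of_mem huI]
      have h1 := hd u ((hI u huI).trans hed)
      have h2 : q' ^ n ≤ w u ^ n := pow_le_pow_left₀ (hq0.trans hqq').le (he u (hI u huI)).le n
      have h3 : w u ^ n * g u ≤ q' ^ n * (g x / 2) := by
        have h4 : 0 ≤ w u ^ n := by positivity
        have h5 : 0 ≤ q' ^ n := pow_nonneg (hq0.trans hqq').le n
        nlinarith
      have : 0 ≤ q ^ n * ‖g u‖ := by positivity
      linarith
    · rw [Set.indicator_of_notMem huI, add_zero]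
      by_cases hud : |u / x - 1| < d
      · have h1 : w u ^ n * g u ≤ 0 :=
          mul_nonpos_of_nonneg_of_nonpos (by positivity) ((hd u hud).le.trans (by linarith))
        exact h1.trans (by positivity)
      · calc w u ^ n * g u ≤ w u ^ n * ‖g u‖ := by gcongr; exact Real.le_norm_self _
          _ ≤ q ^ n * ‖g u‖ := by gcongr; exact hwq u (not_lt.1 hud)
  -- The interval `I` has length 2xe and the bound on it is q'^n g(x)/2, whence the term q'^n x e
  -- g(x).
  have hup : ∀ n : ℕ, 0 ≤ q ^ n * (∫ u in Set.Ioi 0, ‖g u‖) + q' ^ n * (x * e * g x) := by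
    intro n
    have hi2 : IntegrableOn (I.indicator fun _ => q' ^ n * (g x / 2)) (Set.Ioi 0) := by
      rw [integrableOn_indicator_iff measurableSet_Ioo]
      exact (integrableOn_const (by simp)).mono_set Set.inter_subset_left
    have h1 : ∫ u in Set.Ioi 0, w u ^ n * g u ≤ ∫ u in Set.Ioi 0,
        (q ^ n * ‖g u‖ + I.indicator (fun _ => q' ^ n * (g x / 2)) u) := by
      by_cases hin : IntegrableOn (fun u => w u ^ n * g u) (Set.Ioi 0)
      · exact setIntegral_mono_on hin ((hgi.norm.const_mul _).add hi2) measurableSet_Ioi (hbound n)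
      · exfalso
        refine hin ((hgi.norm.const_mul ((1 : ℝ) ^ n)).mono'
          ((hwc.pow n).aestronglyMeasurable.mul hgi.1) ?_)
        filter_upwards [ae_restrict_mem measurableSet_Ioi] with u hu
        have hu0 : 0 ≤ w u := hw0 u (le_of_lt hu)
        have hu1 : w u ≤ 1 := by
          by_cases h0 : u / x - 1 = 0
          · simp only [w]
            rw [h0]
            simp
          · exact (one_add_mul_exp_neg_lt_one h0).le
        rw [norm_mul, norm_pow, Real.norm_of_nonneg hu0]
        gcongr
    rw [integral_add (hgi.norm.const_mul _) hi2, integral_const_mul,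
      setIntegral_indicator measurableSet_Ioo, Set.inter_eq_right.2 hIs] at h1
    refine (hmom n).trans (h1.trans (le_of_eq ?_))
    congr 1
    rw [setIntegral_const, smul_eq_mul, Real.volume_real_Ioo_of_le (by nlinarith)]
    ring
  -- After division by q'^n the positive term tends to 0 while the negative one stays fixed,
  -- contradicting `hup`.
  have hlim : Filter.Tendsto (fun n : ℕ => (q / q') ^ n * (∫ u in Set.Ioi 0, ‖g u‖))
      Filter.atTop (nhds (0 * ∫ u in Set.Ioi 0, ‖g u‖)) :=
    (tendsto_pow_atTop_nhds_zero_of_lt_one (by have := hq0.trans hqq'; positivity)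
      ((div_lt_one (hq0.trans hqq')).2 hqq')).mul_const _
  rw [zero_mul] at hlim
  have hneg' : 0 < -(x * e * g x) := by
    have : x * e * g x < 0 := mul_neg_of_pos_of_neg (by positivity) hgx
    linarith
  obtain ⟨n, hn⟩ := (hlim.eventually_lt_const hneg').exists
  have hq'n : 0 < q' ^ n := pow_pos (hq0.trans hqq') n
  have h1 := hup n
  rw [div_pow] at hn
  have h2 : q' ^ n * (q ^ n / q' ^ n * ∫ u in Set.Ioi 0, ‖g u‖) < q' ^ n * -(x * e * g x) := by
    gcongr
  have h3 : q' ^ n * (q ^ n / q' ^ n * ∫ u in Set.Ioi 0, ‖g u‖) =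
      q ^ n * ∫ u in Set.Ioi 0, ‖g u‖ := by field_simp
  linarith

/-- Inversion of a completely monotone Laplace transform. -/
lemma nonneg_of_alternatingDeriv {f : ℝ → ℝ} {s₀ : ℝ} (hc : ContinuousOn f (Set.Ioi 0))
    (hf : ∀ s > s₀, IntegrableOn (fun u => Real.exp (-(s * u)) * f u) (Set.Ioi 0))
    (h : ∀ n, AlternatingDeriv s₀ n fun s => ∫ u in Set.Ioi 0, Real.exp (-(s * u)) * f u)
    {x : ℝ} (hx : 0 < x) : 0 ≤ f x := by
  refine nonneg_of_expMoment_nonneg hc hf (expMoment_nonneg hf fun n => ?_) hx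
  refine (h n).congr fun s _ => ?_
  simp [expMoment]

end CompletelyMonotone

/-! ### Resolvent, nonnegativity and integrability of the matrix kernel. -/

section Kernel

/-- Sub-intensity matrices, not necessarily nonsingular. -/
structure IsSubIntensity {S : Type*} [Fintype S] (T : Matrix S S ℝ) : Prop where
  offDiag_nonneg : ∀ i j, i ≠ j → 0 ≤ T i j
  exit_nonneg : ∀ i, 0 ≤ exitVector T i

lemma pos_of_large {S : Type*} [Fintype S] {T : Matrix S S ℝ} {α s : ℝ}
    (hs : entrySum T ^ α⁻¹ < s) : 0 < s :=
  (Real.rpow_nonneg (entrySum_nonneg T) _).trans_lt hs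

/-- The threshold `entrySum T ^ α⁻¹` is the common s₀ of all statements for large s: beyond it the
Neumann series converges. -/
lemma entrySum_lt_of_large {S : Type*} [Fintype S] {T : Matrix S S ℝ} {α s : ℝ} (hα : 0 < α)
    (hs : entrySum T ^ α⁻¹ < s) : entrySum T < s ^ α :=
  (Real.rpow_inv_lt_iff_of_pos (entrySum_nonneg T) (pos_of_large hs).le hα).1 hs

variable {S : Type*} [Fintype S]

lemma exitVector_apply (T : Matrix S S ℝ) (i : S) : exitVector T i = -∑ j, T i j := by
  simp [exitVector, Matrix.mulVec, dotProduct]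

variable [DecidableEq S] {T : Matrix S S ℝ}

lemma diagonal_sub_mulVec (d x : S → ℝ) (i : S) :
    ((diagonal d - T) *ᵥ x) i = d i * x i - ∑ j, T i j * x j := by
  rw [sub_mulVec, Pi.sub_apply, mulVec_diagonal]
  rfl

/-- The minimum principle. -/
lemma IsSubIntensity.nonneg_of_mulVec_nonneg (hT : IsSubIntensity T) {d x : S → ℝ}
    (hd : ∀ i, 0 < d i) (hx : ∀ i, 0 ≤ ((diagonal d - T) *ᵥ x) i) (i : S) : 0 ≤ x i := by
  obtain ⟨m, -, hm⟩ := Finset.exists_min_image Finset.univ x ⟨i, Finset.mem_univ i⟩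
  refine le_trans ?_ (hm i (Finset.mem_univ i))
  have h1 := hx m
  rw [diagonal_sub_mulVec] at h1
  have h2 : ∑ j, T m j * x m ≤ ∑ j, T m j * x j := by
    refine Finset.sum_le_sum fun j _ => ?_
    by_cases hj : m = j
    · rw [hj]
    · exact mul_le_mul_of_nonneg_left (hm j (Finset.mem_univ j)) (hT.offDiag_nonneg m j hj)
  rw [← Finset.sum_mul] at h2
  have h3 := hT.exit_nonneg m
  rw [exitVector_apply] at h3
  have h4 := hd m
  by_contra! h5
  nlinarith

/-- The minimum principle applies to a null vector and to its negative. -/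
lemma IsSubIntensity.det_ne_zero (hT : IsSubIntensity T) {d : S → ℝ} (hd : ∀ i, 0 < d i) :
    (diagonal d - T).det ≠ 0 := by
  intro h
  obtain ⟨v, hv, h0⟩ := Matrix.exists_mulVec_eq_zero_iff.2 h
  refine hv (funext fun i => le_antisymm ?_ ?_)
  · have := hT.nonneg_of_mulVec_nonneg hd (x := -v) (fun i => by simp [mulVec_neg, h0]) i
    simpa using this
  · exact hT.nonneg_of_mulVec_nonneg hd (x := v) (fun i => by simp [h0]) i

/-- The Laplace transforms of the entries of the Mittag-Leffler kernel. -/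
noncomputable def kernelLaplace (α : ℝ) (T : Matrix S S ℝ) (s : ℝ) : Matrix S S ℝ :=
  of fun i j => ∫ x in Set.Ioi 0, Real.exp (-(s * x)) * mlKernel α T x i j

lemma diagonal_sub_mul_kernelLaplace_apply (α s : ℝ) (i j : S) :
    ((diagonal (fun _ => s ^ α) - T) * kernelLaplace α T s : Matrix S S ℝ) i j =
      s ^ α * kernelLaplace α T s i j - ∑ l, T i l * kernelLaplace α T s l j := by
  rw [Matrix.sub_mul, Matrix.sub_apply, diagonal_mul, mul_apply]

variable {α : ℝ} (hα : 0 < α)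

section Large

variable {s : ℝ} (hs : entrySum T ^ α⁻¹ < s)
include hα hs

lemma integrableOn_mlKernel_of_large (i j : S) :
    IntegrableOn (fun x => Real.exp (-(s * x)) * mlKernel α T x i j) (Set.Ioi 0) :=
  (mlKernel_laplace_series hα (pos_of_large hs) T (entrySum_lt_of_large hα hs) i j).1

lemma diagonal_sub_mul_kernelLaplace_of_large :
    (diagonal (fun _ => s ^ α) - T) * kernelLaplace α T s = 1 := by
  ext i j
  rw [diagonal_sub_mul_kernelLaplace_apply]
  exact mlKernel_laplace_resolvent hα (pos_of_large hs) T (entrySum_lt_of_large hα hs) i j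

end Large

/-- Each column of A solves a system with a unit vector on the right, so the minimum principle
applies to it. -/
lemma IsSubIntensity.nonneg_of_mul_eq_one (hT : IsSubIntensity T) {c : ℝ} (hc : 0 < c)
    {A : Matrix S S ℝ} (hA : (diagonal (fun _ => c) - T) * A = 1) (i j : S) : 0 ≤ A i j := by
  refine hT.nonneg_of_mulVec_nonneg (d := fun _ => c) (fun _ => hc) (x := fun i => A i j)
    (fun i => ?_) i
  have h1 : ((diagonal (fun _ => c) - T) *ᵥ fun i => A i j) i = (1 : Matrix S S ℝ) i j := by
    rw [← hA]; rfl
  rw [h1, Matrix.one_apply]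
  split_ifs <;> simp

include hα

/-- The Riccati identity -K' = α s^(α-1) K² expresses the derivative by sums of products of
functions already known to alternate to order n; α ≤ 1 makes the exponent α - 1 admissible in
`rpow`. -/
lemma IsSubIntensity.alternatingDeriv_kernelLaplace (hT : IsSubIntensity T) (hα' : α ≤ 1) (n : ℕ)
    (i j : S) :
    AlternatingDeriv (entrySum T ^ α⁻¹) n fun s => kernelLaplace α T s i j := by
  have hs₀ : 0 ≤ entrySum T ^ α⁻¹ := Real.rpow_nonneg (entrySum_nonneg T) _
  have hnn : ∀ s > entrySum T ^ α⁻¹, ∀ i j, 0 ≤ kernelLaplace α T s i j := fun s hs i j =>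
    hT.nonneg_of_mul_eq_one (Real.rpow_pos_of_pos (hs₀.trans_lt hs) α)
      (diagonal_sub_mul_kernelLaplace_of_large hα hs) i j
  -- the derivative of the Laplace transform
  have hder : ∀ s > entrySum T ^ α⁻¹, ∀ i j, HasDerivAt (fun s => kernelLaplace α T s i j)
      (-expMoment (fun x => mlKernel α T x i j) 1 s) s := fun s hs i j => by
    have := hasDerivAt_expMoment (f := fun x => mlKernel α T x i j)
      (fun s hs => integrableOn_mlKernel_of_large hα hs i j) 0 hs
    refine this.congr_of_eventuallyEq (Filter.Eventually.of_forall fun u => ?_)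
    simp [kernelLaplace, expMoment]
  have hform : ∀ s > entrySum T ^ α⁻¹, ∀ i j, expMoment (fun x => mlKernel α T x i j) 1 s =
      ∑ l, α * s ^ (α - 1) * (kernelLaplace α T s i l * kernelLaplace α T s l j) := by
    intro s hs i j
    set M : Matrix S S ℝ := of fun i j => expMoment (fun x => mlKernel α T x i j) 1 s
    have hs0 : 0 < s := hs₀.trans_lt hs
    -- This is the derivative of (s^α - T)K = 1, where M = -K'; multiplying by K from the left then
    -- gives the Riccati identity.
    have h1 : (diagonal (fun _ => s ^ α) - T) * M =
        (α * s ^ (α - 1)) • kernelLaplace α T s := by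
      ext i j
      have hd : HasDerivAt (fun s => s ^ α * kernelLaplace α T s i j -
          ∑ l, T i l * kernelLaplace α T s l j) (α * s ^ (α - 1) * kernelLaplace α T s i j +
          s ^ α * (-M i j) - ∑ l, T i l * (-M l j)) s :=
        ((Real.hasDerivAt_rpow_const (Or.inl hs0.ne')).mul (hder s hs i j)).sub
          (HasDerivAt.fun_sum fun l _ => (hder s hs l j).const_mul (T i l))
      have hc : HasDerivAt (fun s => s ^ α * kernelLaplace α T s i j -
          ∑ l, T i l * kernelLaplace α T s l j) 0 s := by
        refine (hasDerivAt_const s ((1 : Matrix S S ℝ) i j)).congr_of_eventuallyEq ?_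
        filter_upwards [Ioi_mem_nhds hs] with u hu
        rw [← diagonal_sub_mul_kernelLaplace_apply, diagonal_sub_mul_kernelLaplace_of_large hα hu]
      have := hd.unique hc
      simp only [mul_neg, Finset.sum_neg_distrib] at this
      rw [Matrix.sub_mul, Matrix.sub_apply, diagonal_mul, mul_apply, Matrix.smul_apply, smul_eq_mul]
      linarith
    have hL := diagonal_sub_mul_kernelLaplace_of_large hα hs
    have h2 : M = (α * s ^ (α - 1)) • (kernelLaplace α T s * kernelLaplace α T s) := by
      rw [← Matrix.mul_smul, ← h1, ← Matrix.mul_assoc, mul_eq_one_comm.1 hL, Matrix.one_mul]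
    change M i j = _
    rw [h2, Matrix.smul_apply, mul_apply, smul_eq_mul, Finset.mul_sum]
  induction n generalizing i j with
  | zero => exact fun s hs => hnn s hs i j
  | succ n ih =>
    refine ⟨fun s hs => hnn s hs i j, _, fun s hs => hder s hs i j, ?_⟩
    refine AlternatingDeriv.congr (AlternatingDeriv.sum Finset.univ fun l =>
      ((AlternatingDeriv.const hα.le).mul (AlternatingDeriv.rpow hs₀ (sub_nonpos.2 hα'))).mul
        ((ih i l).mul (ih l j))) fun s hs => (hform s hs i j).symm

/-- The terms of the series have no common sign; the sign comes from the complete monotonicity of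
the transform. -/
lemma IsSubIntensity.mlKernel_nonneg (hT : IsSubIntensity T) (hα' : α ≤ 1) {x : ℝ} (hx : 0 < x)
    (i j : S) : 0 ≤ mlKernel α T x i j :=
  nonneg_of_alternatingDeriv (f := fun x => mlKernel α T x i j)
    (continuousOn_mlKernel_apply hα T i j)
    (fun _ hs => integrableOn_mlKernel_of_large hα hs i j)
    (fun n => hT.alternatingDeriv_kernelLaplace hα hα' n i j) hx

/-- Because (s^α - T)e = s^α e + t, the difference of the two sides has the Laplace transform s^(-α)
(K(s)t)ᵢ, again completely monotone. The bound provides integrability against e^(-sx) for every s >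
0, not only for large s. -/
lemma IsSubIntensity.sum_mlKernel_le (hT : IsSubIntensity T) (hα' : α ≤ 1) {x : ℝ} (hx : 0 < x)
    (i : S) : ∑ j, mlKernel α T x i j ≤ (Real.Gamma α)⁻¹ * x ^ (α - 1) := by
  have hs₀ : 0 ≤ entrySum T ^ α⁻¹ := Real.rpow_nonneg (entrySum_nonneg T) _
  have h1 : ∀ s > entrySum T ^ α⁻¹, IntegrableOn (fun u : ℝ => Real.exp (-(s * u)) *
      ((Real.Gamma α)⁻¹ * u ^ (α - 1))) (Set.Ioi 0) := fun s hs =>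
    ((integrableOn_rpow_mul_exp hα (hs₀.trans_lt hs)).const_mul (Real.Gamma α)⁻¹).congr
      (Filter.Eventually.of_forall fun u => by ring)
  have h2 : ∀ s > entrySum T ^ α⁻¹, IntegrableOn (fun u : ℝ =>
      ∑ j, Real.exp (-(s * u)) * mlKernel α T u i j) (Set.Ioi 0) := fun s hs =>
    integrable_finsetSum _ fun j _ => integrableOn_mlKernel_of_large hα hs i j
  have hsplit : ∀ s u : ℝ, Real.exp (-(s * u)) *
      ((Real.Gamma α)⁻¹ * u ^ (α - 1) - ∑ j, mlKernel α T u i j) =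
      Real.exp (-(s * u)) * ((Real.Gamma α)⁻¹ * u ^ (α - 1)) -
        ∑ j, Real.exp (-(s * u)) * mlKernel α T u i j := fun s u => by
    rw [mul_sub, Finset.mul_sum]
  refine sub_nonneg.1 (nonneg_of_alternatingDeriv (s₀ := entrySum T ^ α⁻¹)
    (f := fun x => (Real.Gamma α)⁻¹ * x ^ (α - 1) - ∑ j, mlKernel α T x i j) ?_ ?_ ?_ hx)
  · refine ContinuousOn.sub ?_ ?_
    · exact continuousOn_const.mul
        (continuousOn_id.rpow_const fun x hx => Or.inl (ne_of_gt hx))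
    · exact continuousOn_finsetSum _ fun j _ => continuousOn_mlKernel_apply hα T i j
  · intro s hs
    simp_rw [hsplit]
    exact (h1 s hs).sub (h2 s hs)
  · intro n
    refine AlternatingDeriv.congr (AlternatingDeriv.mul
      (AlternatingDeriv.rpow hs₀ (neg_nonpos.2 hα.le)) (AlternatingDeriv.sum Finset.univ fun j =>
        (hT.alternatingDeriv_kernelLaplace hα hα' n i j).mul
          (AlternatingDeriv.const (hT.exit_nonneg j)))) fun s hs => ?_
    have hs0 : 0 < s := hs₀.trans_lt hs
    have hsα : 0 < s ^ α := Real.rpow_pos_of_pos hs0 _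
    simp_rw [hsplit]
    rw [integral_sub (h1 s hs) (h2 s hs), integral_finsetSum _ fun j _ =>
      integrableOn_mlKernel_of_large hα hs i j]
    have h3 : ∫ u in Set.Ioi 0, Real.exp (-(s * u)) * ((Real.Gamma α)⁻¹ * u ^ (α - 1)) =
        (s ^ α)⁻¹ := by
      have := integral_rpow_mul_exp hα hs0 0
      simp only [Nat.cast_zero, mul_zero, zero_add, pow_one] at this
      have hG := (Real.Gamma_pos_of_pos hα).ne'
      rw [show (s ^ α)⁻¹ = (Real.Gamma α)⁻¹ * ((s ^ α)⁻¹ * Real.Gamma α) by field_simp, ← this,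
        ← integral_const_mul]
      exact integral_congr_ae (Filter.Eventually.of_forall fun u => by ring)
    have h4 : kernelLaplace α T s *ᵥ ((diagonal (fun _ => s ^ α) - T) *ᵥ 1) = 1 := by
      rw [mulVec_mulVec, mul_eq_one_comm.1 (diagonal_sub_mul_kernelLaplace_of_large hα hs),
        one_mulVec]
    have h5 : ((diagonal (fun _ => s ^ α) - T) *ᵥ (1 : S → ℝ)) =
        fun j => s ^ α + exitVector T j := by
      ext j
      rw [diagonal_sub_mulVec, exitVector_apply]
      simp
      ring
    have h6 := congrFun h4 i
    rw [h5] at h6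
    simp only [mulVec, dotProduct, mul_add, Finset.sum_add_distrib, Pi.one_apply,
      ← Finset.sum_mul] at h6
    rw [h3, Real.rpow_neg hs0.le]
    change _ = _ - ∑ j, kernelLaplace α T s i j
    field_simp
    linarith

lemma IsSubIntensity.mlKernel_le (hT : IsSubIntensity T) (hα' : α ≤ 1) {x : ℝ} (hx : 0 < x)
    (i j : S) : mlKernel α T x i j ≤ (Real.Gamma α)⁻¹ * x ^ (α - 1) :=
  (Finset.single_le_sum (f := fun j => mlKernel α T x i j)
    (fun j _ => hT.mlKernel_nonneg hα hα' hx i j) (Finset.mem_univ j)).trans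
    (hT.sum_mlKernel_le hα hα' hx i)

lemma IsSubIntensity.integrableOn_mlKernel (hT : IsSubIntensity T) (hα' : α ≤ 1) {s : ℝ}
    (hs : 0 < s) (i j : S) :
    IntegrableOn (fun x => Real.exp (-(s * x)) * mlKernel α T x i j) (Set.Ioi 0) := by
  refine ((integrableOn_rpow_mul_exp hα hs).const_mul (Real.Gamma α)⁻¹).mono'
    ((by fun_prop : Measurable fun x : ℝ => Real.exp (-(s * x))).mul
        (measurable_mlKernel_apply hα T i j)).aestronglyMeasurable ?_
  filter_upwards [ae_restrict_mem measurableSet_Ioi] with x hx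
  have h0 := hT.mlKernel_nonneg hα hα' hx i j
  rw [Real.norm_of_nonneg (by positivity), mul_comm, ← mul_assoc]
  gcongr
  exact hT.mlKernel_le hα hα' hx i j

/-- A nonnegative kernel entry is the density of a measure, and its Laplace transform is the moment
generating function at -s, which is analytic inside its domain. -/
lemma IsSubIntensity.analyticAt_kernelLaplace (hT : IsSubIntensity T) (hα' : α ≤ 1) {s : ℝ}
    (hs : 0 < s) (i j : S) : AnalyticAt ℝ (fun s => kernelLaplace α T s i j) s := by
  set μ : Measure ℝ := (volume.restrict (Set.Ioi 0)).withDensity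
    fun x => ENNReal.ofReal (mlKernel α T x i j)
  have hm : Measurable fun x => ENNReal.ofReal (mlKernel α T x i j) :=
    (measurable_mlKernel_apply hα T i j).ennreal_ofReal
  have htop : ∀ᵐ x ∂volume.restrict (Set.Ioi (0 : ℝ)),
      ENNReal.ofReal (mlKernel α T x i j) < ⊤ := by simp
  have hreal : ∀ t : ℝ, (fun x => (ENNReal.ofReal (mlKernel α T x i j)).toReal •
      Real.exp (t * id x)) =ᵐ[volume.restrict (Set.Ioi (0 : ℝ))]
      fun x => Real.exp (-(-t * x)) * mlKernel α T x i j := fun t => by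
    filter_upwards [ae_restrict_mem measurableSet_Ioi] with x hx
    rw [ENNReal.toReal_ofReal (hT.mlKernel_nonneg hα hα' hx i j), smul_eq_mul, mul_comm]
    simp
  have hset : Set.Iio 0 ⊆ interior (integrableExpSet id μ) := by
    refine interior_maximal (fun t ht => ?_) isOpen_Iio
    change Integrable _ _
    rw [integrable_withDensity_iff_integrable_smul' hm htop, integrable_congr (hreal t)]
    exact hT.integrableOn_mlKernel hα hα' (neg_pos.2 ht) i j
  have h1 : AnalyticAt ℝ (mgf id μ) (-s) := analyticAt_mgf (hset (neg_lt_zero.2 hs))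
  have h2 : AnalyticAt ℝ (fun s : ℝ => mgf id μ (-s)) s :=
    h1.comp_of_eq (analyticAt_id.neg) rfl
  refine h2.congr (Filter.Eventually.of_forall fun t => ?_)
  simp only [mgf]
  rw [integral_withDensity_eq_integral_toReal_smul hm htop, integral_congr_ae (hreal (-t))]
  simp [kernelLaplace]

/-- The Laplace transform of the kernel is the resolvent `(s^α - T)⁻¹`. -/
lemma IsSubIntensity.diagonal_sub_mul_kernelLaplace (hT : IsSubIntensity T) (hα' : α ≤ 1) {s : ℝ}
    (hs : 0 < s) : (diagonal (fun _ => s ^ α) - T) * kernelLaplace α T s = 1 := by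
  have hs₀ : 0 ≤ entrySum T ^ α⁻¹ := Real.rpow_nonneg (entrySum_nonneg T) _
  ext i j
  rw [diagonal_sub_mul_kernelLaplace_apply]
  have hA : AnalyticOnNhd ℝ (fun s => s ^ α * kernelLaplace α T s i j -
      ∑ l, T i l * kernelLaplace α T s l j) (Set.Ioi 0) := fun u hu =>
    ((Real.contDiffAt_rpow_const_of_ne (ne_of_gt hu)).analyticAt.mul
      (hT.analyticAt_kernelLaplace hα hα' hu i j)).sub
      (Finset.analyticAt_fun_sum _ fun l _ =>
        analyticAt_const.mul (hT.analyticAt_kernelLaplace hα hα' hu l j))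
  have hs1 : entrySum T ^ α⁻¹ < entrySum T ^ α⁻¹ + 1 := by linarith
  -- Both sides are analytic on (0, ∞) and agree beyond the threshold, so the identity theorem
  -- applies.
  refine hA.eqOn_of_preconnected_of_eventuallyEq
    (g := fun _ => (1 : Matrix S S ℝ) i j) analyticOnNhd_const isPreconnected_Ioi
    (z₀ := entrySum T ^ α⁻¹ + 1) (hs₀.trans_lt hs1) ?_ hs
  filter_upwards [Ioi_mem_nhds hs1] with u hu
  rw [← diagonal_sub_mul_kernelLaplace_apply, diagonal_sub_mul_kernelLaplace_of_large hα hu]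

lemma IsSubIntensity.kernelLaplace_nonneg (hT : IsSubIntensity T) (hα' : α ≤ 1) {s : ℝ}
    (hs : 0 < s) (i j : S) : 0 ≤ kernelLaplace α T s i j :=
  hT.nonneg_of_mul_eq_one (Real.rpow_pos_of_pos hs α)
    (hT.diagonal_sub_mul_kernelLaplace hα hα' hs) i j

lemma measurable_dotProduct_mlKernel (a b : S → ℝ) :
    Measurable fun x => a ⬝ᵥ (mlKernel α T x *ᵥ b) := by
  simp only [dotProduct, mulVec]
  exact Finset.measurable_fun_sum _ fun i _ => (Finset.measurable_fun_sum _ fun j _ =>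
    (measurable_mlKernel_apply hα T i j).mul_const _).const_mul _

lemma IsSubIntensity.dotProduct_mlKernel_nonneg (hT : IsSubIntensity T) (hα' : α ≤ 1) {x : ℝ}
    (hx : 0 < x) {a b : S → ℝ} (ha : ∀ i, 0 ≤ a i) (hb : ∀ i, 0 ≤ b i) :
    0 ≤ a ⬝ᵥ (mlKernel α T x *ᵥ b) :=
  Finset.sum_nonneg fun i _ => mul_nonneg (ha i) (Finset.sum_nonneg fun j _ =>
    mul_nonneg (hT.mlKernel_nonneg hα hα' hx i j) (hb j))

lemma IsSubIntensity.lintegral_mlKernel (hT : IsSubIntensity T) (hα' : α ≤ 1) {s : ℝ}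
    (hs : 0 < s) {a b : S → ℝ} (ha : ∀ i, 0 ≤ a i) (hb : ∀ i, 0 ≤ b i) :
    ∫⁻ x in Set.Ioi 0, ENNReal.ofReal (Real.exp (-(s * x)) * (a ⬝ᵥ (mlKernel α T x *ᵥ b))) =
      ENNReal.ofReal (a ⬝ᵥ (kernelLaplace α T s *ᵥ b)) := by
  have hexp : ∀ x, Real.exp (-(s * x)) * (a ⬝ᵥ (mlKernel α T x *ᵥ b)) =
      ∑ i, ∑ j, a i * b j * (Real.exp (-(s * x)) * mlKernel α T x i j) := fun x => by
    simp only [dotProduct, mulVec, Finset.mul_sum]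
    exact Finset.sum_congr rfl fun i _ => Finset.sum_congr rfl fun j _ => by ring
  have hint : ∀ i j, Integrable (fun x => a i * b j * (Real.exp (-(s * x)) * mlKernel α T x i j))
      (volume.restrict (Set.Ioi 0)) := fun i j =>
    (hT.integrableOn_mlKernel hα hα' hs i j).const_mul _
  rw [← ofReal_integral_eq_lintegral_ofReal]
  · congr 1
    simp_rw [hexp]
    rw [integral_finsetSum _ fun i _ => integrable_finsetSum _ fun j _ => hint i j]
    simp only [dotProduct, mulVec, Finset.mul_sum]
    refine Finset.sum_congr rfl fun i _ => ?_
    rw [integral_finsetSum _ fun j _ => hint i j]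
    refine Finset.sum_congr rfl fun j _ => ?_
    rw [integral_const_mul, kernelLaplace, of_apply]
    ring
  · simp_rw [hexp]
    exact integrable_finsetSum _ fun i _ => integrable_finsetSum _ fun j _ => hint i j
  · filter_upwards [ae_restrict_mem measurableSet_Ioi] with x hx
    exact mul_nonneg (Real.exp_nonneg _) (hT.dotProduct_mlKernel_nonneg hα hα' hx ha hb)

end Kernel

/-! ### Uniqueness of the Laplace transform on the orthant. -/

section Uniqueness

open scoped NNReal BoundedContinuousFunction

variable {n : ℕ}

/-- The function `exp (-⟨z, θ⟩)` on the orthant. -/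
noncomputable def expChar (θ : Fin n → ℝ≥0) : (Fin n → ℝ≥0) →ᵇ ℝ :=
  BoundedContinuousFunction.ofNormedAddCommGroup
    (fun z => Real.exp (-∑ k, (z k : ℝ) * θ k)) (by fun_prop) 1 fun z => by
      rw [Real.norm_of_nonneg (Real.exp_nonneg _), Real.exp_le_one_iff, neg_nonpos]
      positivity

lemma expChar_apply (θ z : Fin n → ℝ≥0) :
    expChar θ z = Real.exp (-∑ k, (z k : ℝ) * θ k) := rfl

/-- The characters `exp (-⟨z, θ⟩)` as a homomorphism in `θ`. -/
noncomputable def expCharHom (n : ℕ) :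
    Multiplicative (Fin n → ℝ≥0) →* ((Fin n → ℝ≥0) →ᵇ ℝ) where
  toFun θ := expChar (Multiplicative.toAdd θ)
  map_one' := by
    ext z
    simp [expChar_apply]
  map_mul' θ θ' := by
    ext z
    simp [expChar_apply, mul_add, Finset.sum_add_distrib, Real.exp_add, mul_comm]

/-- The algebra generated by the characters. -/
noncomputable def expCharAlgebra (n : ℕ) : StarSubalgebra ℝ ((Fin n → ℝ≥0) →ᵇ ℝ) where
  toSubalgebra := Algebra.adjoin ℝ (MonoidHom.mrange (expCharHom n))
  star_mem' {a} ha := by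
    have : star a = a := by ext z; simp
    exact this ▸ ha

/-- The exponentials are bounded on the orthant, which is why it is taken as the space itself; they
separate points, and the algebra they generate determines finite measures. -/
lemma orthant_measure_ext {μ ν : Measure (Fin n → ℝ≥0)} [IsFiniteMeasure μ] [IsFiniteMeasure ν]
    (h : ∀ θ, ∫ z, expChar θ z ∂μ = ∫ z, expChar θ z ∂ν) : μ = ν := by
  refine ext_of_forall_mem_subalgebra_integral_eq_of_polish (𝕜 := ℝ) (A := expCharAlgebra n) ?_ ?_
  · intro x y hxy
    obtain ⟨k, hk⟩ := Function.ne_iff.1 hxy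
    refine ⟨_, ⟨_, ⟨expChar (Pi.single k 1), ?_, rfl⟩, rfl⟩, ?_⟩
    · exact Algebra.subset_adjoin ⟨Multiplicative.ofAdd (Pi.single k 1), rfl⟩
    · change expChar (Pi.single k 1) x ≠ expChar (Pi.single k 1) y
      simpa [expChar_apply, Pi.single_apply, apply_ite] using hk
  · intro g hg
    have hg' : g ∈ Subalgebra.toSubmodule (Algebra.adjoin ℝ
        (MonoidHom.mrange (expCharHom n) : Set ((Fin n → ℝ≥0) →ᵇ ℝ))) := hg
    -- The exponentials are closed under products, so this algebra is their linear span and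
    -- linearity of the integral suffices.
    rw [Algebra.adjoin_eq_span, Submonoid.closure_eq] at hg'
    clear hg
    induction hg' using Submodule.span_induction with
    | mem g hg =>
      obtain ⟨θ, rfl⟩ := hg
      exact h _
    | zero => simp
    | add f g _ _ hf hg =>
      simp only [BoundedContinuousFunction.coe_add, Pi.add_apply]
      rw [integral_add (f.integrable _) (g.integrable _),
        integral_add (f.integrable _) (g.integrable _), hf, hg]
    | smul c f _ hf =>
      simp only [BoundedContinuousFunction.coe_smul]
      rw [integral_smul, integral_smul, hf]

/-- A measure on the orthant is determined by its Laplace transform on the interior, provided that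
the latter is finite. -/
lemma measure_ext_of_laplace {μ ν : Measure (Fin n → ℝ)} (hμ : ∀ᵐ y ∂μ, ∀ k, 0 ≤ y k)
    (hν : ∀ᵐ y ∂ν, ∀ k, 0 ≤ y k)
    (h : ∀ θ : Fin n → ℝ, (∀ k, 0 < θ k) → ∫⁻ y, ENNReal.ofReal (Real.exp (-(y ⬝ᵥ θ))) ∂μ =
      ∫⁻ y, ENNReal.ofReal (Real.exp (-(y ⬝ᵥ θ))) ∂ν)
    (hfin : ∀ θ : Fin n → ℝ, (∀ k, 0 < θ k) →
      ∫⁻ y, ENNReal.ofReal (Real.exp (-(y ⬝ᵥ θ))) ∂μ ≠ ⊤) : μ = ν := by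
  -- Weighting with e^(-⟨y, 1⟩) makes the measures finite and shifts θ ≥ 0 to θ + 1 > 0, so that the
  -- transform on the interior is enough. The weight is positive and finite, hence it can be divided
  -- out again.
  set w : (Fin n → ℝ) → ENNReal := fun y => ENNReal.ofReal (Real.exp (-(y ⬝ᵥ 1)))
  have hdot : ∀ θ : Fin n → ℝ, Measurable fun y : Fin n → ℝ => y ⬝ᵥ θ := fun θ => by
    simp only [dotProduct]; fun_prop
  have hw : Measurable w := (hdot 1).neg.exp.ennreal_ofReal
  set p : (Fin n → ℝ) → (Fin n → ℝ≥0) := fun y k => (y k).toNNReal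
  have hp : Measurable p := by fun_prop
  set c : (Fin n → ℝ≥0) → (Fin n → ℝ) := fun z k => z k
  have hc : Measurable c := by fun_prop
  have hcp : ∀ y : Fin n → ℝ, (∀ k, 0 ≤ y k) → c (p y) = y := fun y hy =>
    funext fun k => Real.coe_toNNReal _ (hy k)
  have hlap : ∀ {κ : Measure (Fin n → ℝ)}, (∀ᵐ y ∂κ, ∀ k, 0 ≤ y k) → ∀ θ : Fin n → ℝ≥0,
      ∫⁻ z, ENNReal.ofReal (expChar θ z) ∂(κ.withDensity w).map p =
        ∫⁻ y, ENNReal.ofReal (Real.exp (-(y ⬝ᵥ fun k => (θ k : ℝ) + 1))) ∂κ := by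
    intro κ hκ θ
    have hm : Measurable fun z => ENNReal.ofReal (expChar θ z) :=
      (expChar θ).continuous.measurable.ennreal_ofReal
    rw [lintegral_map hm hp]
    refine (lintegral_withDensity_eq_lintegral_mul _ hw (hm.comp hp)).trans ?_
    refine lintegral_congr_ae ?_
    filter_upwards [hκ] with y hy
    simp only [Pi.mul_apply, Function.comp_apply, w, expChar_apply, p]
    rw [← ENNReal.ofReal_mul (Real.exp_nonneg _), ← Real.exp_add]
    congr 2
    simp only [dotProduct, mul_add, Finset.sum_add_distrib, Pi.one_apply, mul_one,
      Real.coe_toNNReal _ (hy _)]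
    ring
  have hfinite : ∀ {κ : Measure (Fin n → ℝ)}, (∀ᵐ y ∂κ, ∀ k, 0 ≤ y k) →
      (∀ θ : Fin n → ℝ, (∀ k, 0 < θ k) →
      ∫⁻ y, ENNReal.ofReal (Real.exp (-(y ⬝ᵥ θ))) ∂κ ≠ ⊤) →
      IsFiniteMeasure ((κ.withDensity w).map p) := by
    intro κ hκ hκf
    refine ⟨?_⟩
    have h1 := hlap hκ 0
    have h2 : ∀ z, ENNReal.ofReal (expChar (0 : Fin n → ℝ≥0) z) = 1 := fun z => by
      simp [expChar_apply]
    simp only [h2, lintegral_one] at h1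
    rw [h1]
    exact (hκf _ fun k => by positivity).lt_top
  have hfinμ := hfinite hμ hfin
  have hfinν := hfinite hν fun θ hθ => h θ hθ ▸ hfin θ hθ
  have heq : (μ.withDensity w).map p = (ν.withDensity w).map p := by
    refine orthant_measure_ext fun θ => ?_
    have hnn : ∀ z, 0 ≤ expChar θ z := fun z => Real.exp_nonneg _
    rw [integral_eq_lintegral_of_nonneg_ae (Filter.Eventually.of_forall hnn)
      (expChar θ).continuous.measurable.aestronglyMeasurable,
      integral_eq_lintegral_of_nonneg_ae (Filter.Eventually.of_forall hnn)
      (expChar θ).continuous.measurable.aestronglyMeasurable, hlap hμ, hlap hν, h]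
    intro k
    positivity
  have hback : ∀ {κ : Measure (Fin n → ℝ)}, (∀ᵐ y ∂κ, ∀ k, 0 ≤ y k) →
      (((κ.withDensity w).map p).map c).withDensity (fun y => (w y)⁻¹) = κ := by
    intro κ hκ
    rw [Measure.map_map hc hp, Measure.map_congr (g := id), Measure.map_id]
    · exact withDensity_inv_same hw (Filter.Eventually.of_forall fun y => by simp [w, Real.exp_pos])
        (Filter.Eventually.of_forall fun y => by simp [w])
    · filter_upwards [(withDensity_absolutelyContinuous κ w).ae_le hκ] with y hy using hcp y hy
  rw [← hback hμ, heq, hback hν]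

end Uniqueness

/-! ### Integration against the piecewise measure. -/

section Piecewise

/-- The measure-preserving shear u = y, v = x - y maps the sector to the quadrant; the coordinate y
is put outside, so that for fixed u only a translation remains. -/
lemma lintegral_lower (G : (Fin 2 → ℝ) → ENNReal) (hG : Measurable G) :
    ∫⁻ z in {z : Fin 2 → ℝ | 0 < z 1 ∧ z 1 < z 0}, G z =
      ∫⁻ u in Set.Ioi (0 : ℝ), ∫⁻ v in Set.Ioi (0 : ℝ), G ![u + v, u] := by
  have hs : MeasurableSet {z : Fin 2 → ℝ | 0 < z 1 ∧ z 1 < z 0} := by measurability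
  rw [← lintegral_indicator hs, ← (volume_preserving_finTwoArrow ℝ).symm.lintegral_comp
    (hG.indicator hs), Measure.volume_eq_prod, lintegral_prod_symm',
    ← lintegral_indicator measurableSet_Ioi]
  · refine lintegral_congr fun u => ?_
    rw [← lintegral_add_right_eq_self _ u]
    by_cases hu : 0 < u
    · rw [Set.indicator_of_mem (Set.mem_Ioi.2 hu), ← lintegral_indicator measurableSet_Ioi]
      refine lintegral_congr fun v => ?_
      by_cases hv : 0 < v
      · simp [Set.indicator, hu, hv, add_comm]
      · simp [Set.indicator, hu, hv]
    · simp [Set.indicator, hu]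
  · exact (hG.indicator hs).comp (MeasurableEquiv.measurable _)

lemma lintegral_upper (G : (Fin 2 → ℝ) → ENNReal) (hG : Measurable G) :
    ∫⁻ z in {z : Fin 2 → ℝ | 0 < z 0 ∧ z 0 < z 1}, G z =
      ∫⁻ u in Set.Ioi (0 : ℝ), ∫⁻ v in Set.Ioi (0 : ℝ), G ![u, u + v] := by
  have hs : MeasurableSet {z : Fin 2 → ℝ | 0 < z 0 ∧ z 0 < z 1} := by measurability
  rw [← lintegral_indicator hs, ← (volume_preserving_finTwoArrow ℝ).symm.lintegral_comp
    (hG.indicator hs), Measure.volume_eq_prod, lintegral_prod,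
    ← lintegral_indicator measurableSet_Ioi]
  · refine lintegral_congr fun u => ?_
    rw [← lintegral_add_right_eq_self _ u]
    by_cases hu : 0 < u
    · rw [Set.indicator_of_mem (Set.mem_Ioi.2 hu), ← lintegral_indicator measurableSet_Ioi]
      refine lintegral_congr fun v => ?_
      by_cases hv : 0 < v
      · simp [Set.indicator, hu, hv, add_comm]
      · simp [Set.indicator, hu, hv]
    · simp [Set.indicator, hu]
  · exact ((hG.indicator hs).comp (MeasurableEquiv.measurable _)).aemeasurable

lemma lintegral_piecewiseMeasure {f₁ f₂ : ℝ → ℝ → ℝ} {g h₁ h₂ : ℝ → ℝ} (c : ℝ)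
    (hf₁ : Measurable fun z : Fin 2 → ℝ => f₁ (z 0) (z 1))
    (hf₂ : Measurable fun z : Fin 2 → ℝ => f₂ (z 0) (z 1))
    (hg : Measurable g) (hh₁ : Measurable h₁) (hh₂ : Measurable h₂)
    (G : (Fin 2 → ℝ) → ENNReal) (hG : Measurable G) :
    ∫⁻ z, G z ∂piecewiseMeasure f₁ f₂ g h₁ h₂ c =
      (∫⁻ u in Set.Ioi (0 : ℝ), ∫⁻ v in Set.Ioi (0 : ℝ),
        ENNReal.ofReal (f₁ (u + v) u) * G ![u + v, u]) +
      (∫⁻ u in Set.Ioi (0 : ℝ), ∫⁻ v in Set.Ioi (0 : ℝ),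
        ENNReal.ofReal (f₂ u (u + v)) * G ![u, u + v]) +
      (∫⁻ x in Set.Ioi (0 : ℝ), ENNReal.ofReal (g x) * G ![x, x]) +
      (∫⁻ x in Set.Ioi (0 : ℝ), ENNReal.ofReal (h₁ x) * G ![x, 0]) +
      (∫⁻ x in Set.Ioi (0 : ℝ), ENNReal.ofReal (h₂ x) * G ![0, x]) +
      ENNReal.ofReal c * G 0 := by
  have m1 : Measurable fun x : ℝ => (![x, x] : Fin 2 → ℝ) := by fun_prop
  have m2 : Measurable fun x : ℝ => (![x, 0] : Fin 2 → ℝ) := by fun_prop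
  have m3 : Measurable fun x : ℝ => (![0, x] : Fin 2 → ℝ) := by fun_prop
  have hmap : ∀ {m : ℝ → (Fin 2 → ℝ)} {d : ℝ → ℝ}, Measurable m → Measurable d →
      ∫⁻ z, G z ∂((volume.restrict (Set.Ioi 0)).withDensity fun x => ENNReal.ofReal (d x)).map m =
        ∫⁻ x in Set.Ioi (0 : ℝ), ENNReal.ofReal (d x) * G (m x) := fun hm hd => by
    rw [lintegral_map hG hm]
    exact lintegral_withDensity_eq_lintegral_mul _ hd.ennreal_ofReal (hG.comp hm)
  rw [piecewiseMeasure, lintegral_add_measure, lintegral_add_measure, lintegral_add_measure,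
    lintegral_add_measure, lintegral_add_measure, lintegral_smul_measure,
    lintegral_dirac' _ hG, hmap m1 hg, hmap m2 hh₁, hmap m3 hh₂,
    lintegral_withDensity_eq_lintegral_mul _ hf₁.ennreal_ofReal hG,
    lintegral_withDensity_eq_lintegral_mul _ hf₂.ennreal_ofReal hG,
    lintegral_lower _ (hf₁.ennreal_ofReal.mul hG), lintegral_upper _ (hf₂.ennreal_ofReal.mul hG)]
  rfl

lemma piecewiseMeasure_nonneg (f₁ f₂ : ℝ → ℝ → ℝ) (g h₁ h₂ : ℝ → ℝ) (c : ℝ) :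
    ∀ᵐ z ∂piecewiseMeasure f₁ f₂ g h₁ h₂ c, ∀ k, 0 ≤ z k := by
  have m1 : Measurable fun x : ℝ => (![x, x] : Fin 2 → ℝ) := by fun_prop
  have m2 : Measurable fun x : ℝ => (![x, 0] : Fin 2 → ℝ) := by fun_prop
  have m3 : Measurable fun x : ℝ => (![0, x] : Fin 2 → ℝ) := by fun_prop
  have hs : MeasurableSet {z : Fin 2 → ℝ | ∀ k, 0 ≤ z k} := by measurability
  have hpos : ∀ d : ℝ → ENNReal, ∀ᵐ x ∂(volume.restrict (Set.Ioi (0 : ℝ))).withDensity d, 0 < x :=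
    fun d => (withDensity_absolutelyContinuous _ _).ae_le (ae_restrict_mem measurableSet_Ioi)
  simp only [piecewiseMeasure, ae_add_measure_iff]
  refine ⟨⟨⟨⟨⟨?_, ?_⟩, ?_⟩, ?_⟩, ?_⟩, ?_⟩
  · refine (withDensity_absolutelyContinuous _ _).ae_le
      ((ae_restrict_mem (by measurability)).mono fun z hz => ?_)
    rw [Fin.forall_fin_two]
    exact ⟨(hz.1.trans hz.2).le, hz.1.le⟩
  · refine (withDensity_absolutelyContinuous _ _).ae_le
      ((ae_restrict_mem (by measurability)).mono fun z hz => ?_)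
    rw [Fin.forall_fin_two]
    exact ⟨hz.1.le, (hz.1.trans hz.2).le⟩
  · rw [ae_map_iff m1.aemeasurable hs]
    filter_upwards [hpos _] with x hx
    simp [Fin.forall_fin_two, hx.le]
  · rw [ae_map_iff m2.aemeasurable hs]
    filter_upwards [hpos _] with x hx
    simp [Fin.forall_fin_two, hx.le]
  · rw [ae_map_iff m3.aemeasurable hs]
    filter_upwards [hpos _] with x hx
    simp [Fin.forall_fin_two, hx.le]
  · refine Measure.ae_smul_measure ?_ _
    rw [ae_dirac_iff hs]
    simp

end Piecewise

/-! ### The planar densities. -/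

section Plane

lemma mulVec_nonneg {m n : Type*} [Fintype n] {A : Matrix m n ℝ} {v : n → ℝ}
    (hA : ∀ i j, 0 ≤ A i j) (hv : ∀ j, 0 ≤ v j) (i : m) : 0 ≤ (A *ᵥ v) i :=
  Finset.sum_nonneg fun j _ => mul_nonneg (hA i j) (hv j)

variable {p q : ℕ} {α : ℝ} (hα : 0 < α) (hα' : α ≤ 1) {T : Matrix (Fin p) (Fin p) ℝ}
  {T' : Matrix (Fin q) (Fin q) ℝ}

lemma planeDensity_eq (π : Fin p → ℝ) (D : Matrix (Fin p) (Fin q) ℝ) (t : Fin q → ℝ) (u v : ℝ) :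
    planeDensity α π T D T' t u v = (π ᵥ* (mlKernel α T u * D)) ⬝ᵥ (mlKernel α T' v *ᵥ t) := by
  rw [planeDensity, ← mulVec_mulVec, dotProduct_mulVec]

include hα in
lemma measurable_planeDensity (π : Fin p → ℝ) (D : Matrix (Fin p) (Fin q) ℝ) (t : Fin q → ℝ)
    {X : Type*} [MeasurableSpace X] {f g : X → ℝ} (hf : Measurable f) (hg : Measurable g) :
    Measurable fun z => planeDensity α π T D T' t (f z) (g z) := by
  simp only [planeDensity, dotProduct, mulVec, Matrix.mul_apply]
  have h1 : ∀ i j, Measurable fun z => mlKernel α T (f z) i j := fun i j =>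
    (measurable_mlKernel_apply hα T i j).comp hf
  have h2 : ∀ i j, Measurable fun z => mlKernel α T' (g z) i j := fun i j =>
    (measurable_mlKernel_apply hα T' i j).comp hg
  fun_prop

variable {π : Fin p → ℝ} {D : Matrix (Fin p) (Fin q) ℝ} {t : Fin q → ℝ}
  (hT : IsSubIntensity T) (hT' : IsSubIntensity T') (hπ : ∀ i, 0 ≤ π i) (hD : ∀ i j, 0 ≤ D i j)
  (ht : ∀ i, 0 ≤ t i)
include hα hα' hT hT' hπ hD ht

omit hT' ht in
lemma vecMul_mlKernel_mul_nonneg {u : ℝ} (hu : 0 < u) (j : Fin q) :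
    0 ≤ (π ᵥ* (mlKernel α T u * D)) j := by
  simp only [vecMul, dotProduct, Matrix.mul_apply]
  exact Finset.sum_nonneg fun i _ => mul_nonneg (hπ i)
    (Finset.sum_nonneg fun l _ => mul_nonneg (hT.mlKernel_nonneg hα hα' hu i l) (hD l j))

lemma planeDensity_nonneg {u v : ℝ} (hu : 0 < u) (hv : 0 < v) :
    0 ≤ planeDensity α π T D T' t u v := by
  rw [planeDensity_eq]
  exact hT'.dotProduct_mlKernel_nonneg hα hα' hv
    (vecMul_mlKernel_mul_nonneg hα hα' hT hπ hD hu) ht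

/-- For fixed u the integral over v is one of a line density with the row vector πK(u)D; the
integral over u is then another, with the column vector D K̂(r) t, where K̂ is the transform of the
second kernel. -/
lemma lintegral_planeDensity {s r : ℝ} (hs : 0 < s) (hr : 0 < r) :
    ∫⁻ u in Set.Ioi (0 : ℝ), ∫⁻ v in Set.Ioi (0 : ℝ),
      ENNReal.ofReal (planeDensity α π T D T' t u v) *
        ENNReal.ofReal (Real.exp (-(s * u + r * v))) =
      ENNReal.ofReal (π ⬝ᵥ (kernelLaplace α T s *ᵥ (D *ᵥ (kernelLaplace α T' r *ᵥ t)))) := by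
  have hb : ∀ i, 0 ≤ (D *ᵥ (kernelLaplace α T' r *ᵥ t)) i :=
    mulVec_nonneg hD (mulVec_nonneg (hT'.kernelLaplace_nonneg hα hα' hr) ht)
  rw [← hT.lintegral_mlKernel hα hα' hs hπ hb]
  refine setLIntegral_congr_fun measurableSet_Ioi fun u hu => ?_
  have ha := vecMul_mlKernel_mul_nonneg hα hα' hT hπ hD hu
  have h1 : ∀ v : ℝ, ENNReal.ofReal (planeDensity α π T D T' t u v) *
      ENNReal.ofReal (Real.exp (-(s * u + r * v))) = ENNReal.ofReal (Real.exp (-(s * u))) *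
      ENNReal.ofReal (Real.exp (-(r * v)) *
        ((π ᵥ* (mlKernel α T u * D)) ⬝ᵥ (mlKernel α T' v *ᵥ t))) := fun v => by
    rw [planeDensity_eq, neg_add, Real.exp_add, mul_comm,
      ← ENNReal.ofReal_mul (by positivity), ← ENNReal.ofReal_mul (by positivity), mul_assoc]
  simp_rw [h1]
  rw [lintegral_const_mul', hT'.lintegral_mlKernel hα hα' hr ha ht,
    ← ENNReal.ofReal_mul (by positivity)]
  · congr 2
    rw [← dotProduct_mulVec, mulVec_mulVec, mulVec_mulVec, mulVec_mulVec]
  · exact ENNReal.ofReal_ne_top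

end Plane

lemma IsPHParam.isSubIntensity {S : Type*} [Fintype S] [DecidableEq S] {π : S → ℝ}
    {T : Matrix S S ℝ} (h : IsPHParam π T) : IsSubIntensity T :=
  ⟨h.offDiag_nonneg, h.exit_nonneg⟩

/-! ### The block structure and the Laplace transform of the explicit form. -/

section Block

variable {p₁ p₂ p₃ : ℕ} {T₁₁ : Matrix (Fin p₁) (Fin p₁) ℝ} {T₁₂ : Matrix (Fin p₁) (Fin p₂) ℝ}
  {T₁₃ : Matrix (Fin p₁) (Fin p₃) ℝ} {T₂₂ : Matrix (Fin p₂) (Fin p₂) ℝ}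
  {T₃₃ : Matrix (Fin p₃) (Fin p₃) ℝ}

lemma exitVector_blockT_inl (i : Fin p₁) :
    exitVector (blockT T₁₁ T₁₂ T₁₃ T₂₂ T₃₃) (Sum.inl i) =
      exitVector T₁₁ i - (∑ j, T₁₂ i j + ∑ j, T₁₃ i j) := by
  simp [exitVector_apply, blockT, Fintype.sum_sum_type]
  ring

lemma exitVector_blockT_inr_inl (i : Fin p₂) :
    exitVector (blockT T₁₁ T₁₂ T₁₃ T₂₂ T₃₃) (Sum.inr (Sum.inl i)) = exitVector T₂₂ i := by
  simp [exitVector_apply, blockT, Fintype.sum_sum_type]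

lemma exitVector_blockT_inr_inr (i : Fin p₃) :
    exitVector (blockT T₁₁ T₁₂ T₁₃ T₂₂ T₃₃) (Sum.inr (Sum.inr i)) = exitVector T₃₃ i := by
  simp [exitVector_apply, blockT, Fintype.sum_sum_type]

section SubIntensity

variable (hT : IsSubIntensity (blockT T₁₁ T₁₂ T₁₃ T₂₂ T₃₃))
include hT

lemma IsSubIntensity.block₁₂_nonneg (i : Fin p₁) (j : Fin p₂) : 0 ≤ T₁₂ i j := by
  simpa [blockT] using hT.offDiag_nonneg (Sum.inl i) (Sum.inr (Sum.inl j)) (by simp)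

lemma IsSubIntensity.block₁₃_nonneg (i : Fin p₁) (j : Fin p₃) : 0 ≤ T₁₃ i j := by
  simpa [blockT] using hT.offDiag_nonneg (Sum.inl i) (Sum.inr (Sum.inr j)) (by simp)

/-- Leaving the first block includes jumps to the other two, so the exit rates of `T₁₁` are t₁ +
T₁₂e + T₁₃e. -/
lemma IsSubIntensity.block₁₁ : IsSubIntensity T₁₁ where
  offDiag_nonneg i j hij := by
    simpa [blockT] using hT.offDiag_nonneg (Sum.inl i) (Sum.inl j) (by simpa using hij)
  exit_nonneg i := by
    have h1 := hT.exit_nonneg (Sum.inl i)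
    have h2 : 0 ≤ ∑ j, T₁₂ i j := Finset.sum_nonneg fun j _ => hT.block₁₂_nonneg i j
    have h3 : 0 ≤ ∑ j, T₁₃ i j := Finset.sum_nonneg fun j _ => hT.block₁₃_nonneg i j
    rw [exitVector_blockT_inl] at h1
    linarith

lemma IsSubIntensity.block₂₂ : IsSubIntensity T₂₂ where
  offDiag_nonneg i j hij := by
    simpa [blockT] using hT.offDiag_nonneg (Sum.inr (Sum.inl i)) (Sum.inr (Sum.inl j))
      (by simpa using hij)
  exit_nonneg i := exitVector_blockT_inr_inl (T₁₁ := T₁₁) i ▸ hT.exit_nonneg _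

lemma IsSubIntensity.block₃₃ : IsSubIntensity T₃₃ where
  offDiag_nonneg i j hij := by
    simpa [blockT] using hT.offDiag_nonneg (Sum.inr (Sum.inr i)) (Sum.inr (Sum.inr j))
      (by simpa using hij)
  exit_nonneg i := exitVector_blockT_inr_inr (T₁₁ := T₁₁) i ▸ hT.exit_nonneg _

end SubIntensity

/-- On each block the diagonal matrix Δ(Rθ)^α is a multiple of the identity; this is what makes the
block resolvents Laplace transforms of kernels. -/
lemma blockR_mulVec (θ : Fin 2 → ℝ) : blockR p₁ p₂ p₃ *ᵥ θ =
    Sum.elim (fun _ => θ 0 + θ 1) (Sum.elim (fun _ => θ 0) fun _ => θ 1) := by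
  ext i
  rcases i with i | i | i <;> simp [blockR, mulVec, dotProduct, Fin.sum_univ_two]

lemma mulVec_mulVec_of_mul_eq_one {m : Type*} [Fintype m] [DecidableEq m] {A B : Matrix m m ℝ}
    (h : A * B = 1) (v : m → ℝ) : A *ᵥ (B *ᵥ v) = v := by
  rw [mulVec_mulVec, h, one_mulVec]

/-- The block form of the Laplace transform. -/
lemma blockInit_dotProduct_resolvent {α : ℝ} (hα : 0 < α) (hα' : α ≤ 1)
    (hT : IsSubIntensity (blockT T₁₁ T₁₂ T₁₃ T₂₂ T₃₃)) (π₁ : Fin p₁ → ℝ) (π₂ : Fin p₂ → ℝ)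
    (π₃ : Fin p₃ → ℝ) (t₁ : Fin p₁ → ℝ) (t₂ : Fin p₂ → ℝ) (t₃ : Fin p₃ → ℝ) {θ : Fin 2 → ℝ}
    (hθ : ∀ k, 0 < θ k) :
    blockInit π₁ π₂ π₃ ⬝ᵥ ((diagonal (fun i => (blockR p₁ p₂ p₃ *ᵥ θ) i ^ α) -
      blockT T₁₁ T₁₂ T₁₃ T₂₂ T₃₃)⁻¹ *ᵥ Sum.elim t₁ (Sum.elim t₂ t₃)) =
    π₁ ⬝ᵥ (kernelLaplace α T₁₁ (θ 0 + θ 1) *ᵥ (T₁₂ *ᵥ (kernelLaplace α T₂₂ (θ 0) *ᵥ t₂))) +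
    π₁ ⬝ᵥ (kernelLaplace α T₁₁ (θ 0 + θ 1) *ᵥ (T₁₃ *ᵥ (kernelLaplace α T₃₃ (θ 1) *ᵥ t₃))) +
    π₁ ⬝ᵥ (kernelLaplace α T₁₁ (θ 0 + θ 1) *ᵥ t₁) +
    π₂ ⬝ᵥ (kernelLaplace α T₂₂ (θ 0) *ᵥ t₂) + π₃ ⬝ᵥ (kernelLaplace α T₃₃ (θ 1) *ᵥ t₃) := by
  have hθ₀₁ : 0 < θ 0 + θ 1 := add_pos (hθ 0) (hθ 1)
  -- Back substitution from the last two block rows to the first; `hsol` checks the solution, so the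
  -- full matrix need not be inverted by blocks.
  set x₂ := kernelLaplace α T₂₂ (θ 0) *ᵥ t₂ with hx₂
  set x₃ := kernelLaplace α T₃₃ (θ 1) *ᵥ t₃ with hx₃
  set x₁ := kernelLaplace α T₁₁ (θ 0 + θ 1) *ᵥ (T₁₂ *ᵥ x₂ + T₁₃ *ᵥ x₃ + t₁) with hx₁
  have e₁ := mulVec_mulVec_of_mul_eq_one
    (hT.block₁₁.diagonal_sub_mul_kernelLaplace hα hα' hθ₀₁) (T₁₂ *ᵥ x₂ + T₁₃ *ᵥ x₃ + t₁)
  have e₂ := mulVec_mulVec_of_mul_eq_one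
    (hT.block₂₂.diagonal_sub_mul_kernelLaplace hα hα' (hθ 0)) t₂
  have e₃ := mulVec_mulVec_of_mul_eq_one
    (hT.block₃₃.diagonal_sub_mul_kernelLaplace hα hα' (hθ 1)) t₃
  rw [← hx₁] at e₁
  rw [← hx₂] at e₂
  rw [← hx₃] at e₃
  have hd : ∀ i, 0 < (blockR p₁ p₂ p₃ *ᵥ θ) i ^ α := fun i => by
    rw [blockR_mulVec]
    rcases i with i | i | i
    · exact Real.rpow_pos_of_pos hθ₀₁ _
    · exact Real.rpow_pos_of_pos (hθ 0) _
    · exact Real.rpow_pos_of_pos (hθ 1) _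
  have hsol : (diagonal (fun i => (blockR p₁ p₂ p₃ *ᵥ θ) i ^ α) - blockT T₁₁ T₁₂ T₁₃ T₂₂ T₃₃) *ᵥ
      Sum.elim x₁ (Sum.elim x₂ x₃) = Sum.elim t₁ (Sum.elim t₂ t₃) := by
    ext i
    rw [diagonal_sub_mulVec, blockR_mulVec]
    rcases i with i | i | i
    · have := congrFun e₁ i
      rw [diagonal_sub_mulVec] at this
      simp only [Pi.add_apply, mulVec, dotProduct] at this
      simp [blockT, Fintype.sum_sum_type]
      simp only [mulVec, dotProduct] at *
      linarith
    · have := congrFun e₂ i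
      rw [diagonal_sub_mulVec] at this
      simpa [blockT, Fintype.sum_sum_type] using this
    · have := congrFun e₃ i
      rw [diagonal_sub_mulVec] at this
      simpa [blockT, Fintype.sum_sum_type] using this
  rw [← hsol, mulVec_mulVec, nonsing_inv_mul _ (isUnit_iff_ne_zero.2 (hT.det_ne_zero hd)),
    one_mulVec, blockInit]
  simp only [sumElim_dotProduct_sumElim, hx₁, mulVec_add, dotProduct_add]
  ring

lemma measurable_exp_neg_dotProduct {n : ℕ} (θ : Fin n → ℝ) :
    Measurable fun y : Fin n → ℝ => ENNReal.ofReal (Real.exp (-(y ⬝ᵥ θ))) := by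
  simp only [dotProduct]
  fun_prop

lemma lineDensity_nonneg {α : ℝ} (hα : 0 < α) (hα' : α ≤ 1) {p : ℕ}
    {T : Matrix (Fin p) (Fin p) ℝ} (hT : IsSubIntensity T) {π t : Fin p → ℝ} (hπ : ∀ i, 0 ≤ π i)
    (ht : ∀ i, 0 ≤ t i) {x : ℝ} (hx : 0 < x) : 0 ≤ lineDensity α π T t x :=
  hT.dotProduct_mlKernel_nonneg hα hα' hx hπ ht

lemma lintegral_lineDensity {α : ℝ} (hα : 0 < α) (hα' : α ≤ 1) {p : ℕ}
    {T : Matrix (Fin p) (Fin p) ℝ} (hT : IsSubIntensity T) {π t : Fin p → ℝ} (hπ : ∀ i, 0 ≤ π i)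
    (ht : ∀ i, 0 ≤ t i) {s : ℝ} (hs : 0 < s) :
    ∫⁻ x in Set.Ioi (0 : ℝ), ENNReal.ofReal (lineDensity α π T t x) *
      ENNReal.ofReal (Real.exp (-(s * x))) = ENNReal.ofReal (π ⬝ᵥ (kernelLaplace α T s *ᵥ t)) := by
  rw [← hT.lintegral_mlKernel hα hα' hs hπ ht]
  refine lintegral_congr fun x => ?_
  rw [mul_comm, ← ENNReal.ofReal_mul (by positivity)]
  rfl

/-- The Laplace transform of the explicit form. -/
lemma lintegral_exp_piecewiseMeasure {α : ℝ} (hα : 0 < α) (hα' : α ≤ 1)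
    (hT : IsSubIntensity (blockT T₁₁ T₁₂ T₁₃ T₂₂ T₃₃)) {π₁ t₁ : Fin p₁ → ℝ} {π₂ t₂ : Fin p₂ → ℝ}
    {π₃ t₃ : Fin p₃ → ℝ} (hπ₁ : ∀ i, 0 ≤ π₁ i) (hπ₂ : ∀ i, 0 ≤ π₂ i) (hπ₃ : ∀ i, 0 ≤ π₃ i)
    (ht₁ : ∀ i, 0 ≤ t₁ i) (ht₂ : ∀ i, 0 ≤ t₂ i) (ht₃ : ∀ i, 0 ≤ t₃ i) {c : ℝ} (hc : 0 ≤ c)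
    {θ : Fin 2 → ℝ} (hθ : ∀ k, 0 < θ k) :
    ∫⁻ y, ENNReal.ofReal (Real.exp (-(y ⬝ᵥ θ))) ∂piecewiseMeasure
        (fun x y => planeDensity α π₁ T₁₁ T₁₂ T₂₂ t₂ y (x - y))
        (fun x y => planeDensity α π₁ T₁₁ T₁₃ T₃₃ t₃ x (y - x))
        (lineDensity α π₁ T₁₁ t₁) (lineDensity α π₂ T₂₂ t₂) (lineDensity α π₃ T₃₃ t₃) c =
      ENNReal.ofReal (c + blockInit π₁ π₂ π₃ ⬝ᵥ
          ((diagonal (fun i => (blockR p₁ p₂ p₃ *ᵥ θ) i ^ α) - blockT T₁₁ T₁₂ T₁₃ T₂₂ T₃₃)⁻¹ *ᵥ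
            Sum.elim t₁ (Sum.elim t₂ t₃))) := by
  have hT₁ := hT.block₁₁
  have hT₂ := hT.block₂₂
  have hT₃ := hT.block₃₃
  have hθ₀₁ : 0 < θ 0 + θ 1 := add_pos (hθ 0) (hθ 1)
  have m₁ : Measurable fun z : Fin 2 → ℝ => planeDensity α π₁ T₁₁ T₁₂ T₂₂ t₂ (z 1) (z 0 - z 1) :=
    measurable_planeDensity hα π₁ T₁₂ t₂ (by fun_prop) (by fun_prop)
  have m₂ : Measurable fun z : Fin 2 → ℝ => planeDensity α π₁ T₁₁ T₁₃ T₃₃ t₃ (z 0) (z 1 - z 0) :=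
    measurable_planeDensity hα π₁ T₁₃ t₃ (by fun_prop) (by fun_prop)
  rw [lintegral_piecewiseMeasure
    (f₁ := fun x y => planeDensity α π₁ T₁₁ T₁₂ T₂₂ t₂ y (x - y))
    (f₂ := fun x y => planeDensity α π₁ T₁₁ T₁₃ T₃₃ t₃ x (y - x))
    (g := lineDensity α π₁ T₁₁ t₁) (h₁ := lineDensity α π₂ T₂₂ t₂)
    (h₂ := lineDensity α π₃ T₃₃ t₃) c m₁ m₂ (measurable_dotProduct_mlKernel hα π₁ t₁)
    (measurable_dotProduct_mlKernel hα π₂ t₂) (measurable_dotProduct_mlKernel hα π₃ t₃) _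
    (measurable_exp_neg_dotProduct θ)]
  have hdot₁ : ∀ u v : ℝ, ![u + v, u] ⬝ᵥ θ = (θ 0 + θ 1) * u + θ 0 * v := fun u v => by
    simp [dotProduct, Fin.sum_univ_two]; ring
  have hdot₂ : ∀ u v : ℝ, ![u, u + v] ⬝ᵥ θ = (θ 0 + θ 1) * u + θ 1 * v := fun u v => by
    simp [dotProduct, Fin.sum_univ_two]; ring
  have hdot₃ : ∀ x : ℝ, ![x, x] ⬝ᵥ θ = (θ 0 + θ 1) * x := fun x => by
    simp [dotProduct, Fin.sum_univ_two]; ring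
  have hdot₄ : ∀ x : ℝ, ![x, 0] ⬝ᵥ θ = θ 0 * x := fun x => by
    simp [dotProduct, Fin.sum_univ_two, mul_comm]
  have hdot₅ : ∀ x : ℝ, ![0, x] ⬝ᵥ θ = θ 1 * x := fun x => by
    simp [dotProduct, Fin.sum_univ_two, mul_comm]
  simp only [add_sub_cancel_left, hdot₁, hdot₂, hdot₃, hdot₄, hdot₅]
  have hL₁ := hT₁.kernelLaplace_nonneg hα hα' hθ₀₁
  have hL₂ := hT₂.kernelLaplace_nonneg hα hα' (hθ 0)
  have hL₃ := hT₃.kernelLaplace_nonneg hα hα' (hθ 1)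
  have dotnn : ∀ {p : ℕ} {a b : Fin p → ℝ}, (∀ i, 0 ≤ a i) → (∀ i, 0 ≤ b i) → 0 ≤ a ⬝ᵥ b :=
    fun ha hb => Finset.sum_nonneg fun i _ => mul_nonneg (ha i) (hb i)
  have n₁ := dotnn hπ₁ (mulVec_nonneg hL₁ (mulVec_nonneg hT.block₁₂_nonneg
    (mulVec_nonneg hL₂ ht₂)))
  have n₂ := dotnn hπ₁ (mulVec_nonneg hL₁ (mulVec_nonneg hT.block₁₃_nonneg
    (mulVec_nonneg hL₃ ht₃)))
  have n₃ := dotnn hπ₁ (mulVec_nonneg hL₁ ht₁)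
  have n₄ := dotnn hπ₂ (mulVec_nonneg hL₂ ht₂)
  have n₅ := dotnn hπ₃ (mulVec_nonneg hL₃ ht₃)
  rw [lintegral_planeDensity hα hα' hT₁ hT₂ hπ₁ hT.block₁₂_nonneg ht₂ hθ₀₁ (hθ 0),
    lintegral_planeDensity hα hα' hT₁ hT₃ hπ₁ hT.block₁₃_nonneg ht₃ hθ₀₁ (hθ 1),
    lintegral_lineDensity hα hα' hT₁ hπ₁ ht₁ hθ₀₁, lintegral_lineDensity hα hα' hT₂ hπ₂ ht₂ (hθ 0),
    lintegral_lineDensity hα hα' hT₃ hπ₃ ht₃ (hθ 1),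
    blockInit_dotProduct_resolvent hα hα' hT π₁ π₂ π₃ t₁ t₂ t₃ hθ, zero_dotProduct, neg_zero,
    Real.exp_zero, ENNReal.ofReal_one, mul_one, add_comm c,
    ENNReal.ofReal_add (add_nonneg (add_nonneg (add_nonneg (add_nonneg n₁ n₂) n₃) n₄) n₅) hc,
    ENNReal.ofReal_add (add_nonneg (add_nonneg (add_nonneg n₁ n₂) n₃) n₄) n₅,
    ENNReal.ofReal_add (add_nonneg (add_nonneg n₁ n₂) n₃) n₄,
    ENNReal.ofReal_add (add_nonneg n₁ n₂) n₃, ENNReal.ofReal_add n₁ n₂]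

/-- A measure on the quadrant whose Laplace transform is that of `MPH*_α(π, T, R)` on the interior
of the quadrant has the explicit form. -/
theorem hasExplicitForm_of_laplace {α : ℝ} (hα : 0 < α) (hα' : α ≤ 1) {π₁ : Fin p₁ → ℝ}
    {π₂ : Fin p₂ → ℝ} {π₃ : Fin p₃ → ℝ}
    (hparam : IsPHParam (blockInit π₁ π₂ π₃) (blockT T₁₁ T₁₂ T₁₃ T₂₂ T₃₃))
    {μ : Measure (Fin 2 → ℝ)} (hμ : ∀ᵐ y ∂μ, ∀ k, 0 ≤ y k)
    (hlap : ∀ θ : Fin 2 → ℝ, (∀ k, 0 < θ k) →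
      ∫⁻ y, ENNReal.ofReal (Real.exp (-(y ⬝ᵥ θ))) ∂μ =
        ENNReal.ofReal ((1 - ∑ i, blockInit π₁ π₂ π₃ i) + blockInit π₁ π₂ π₃ ⬝ᵥ
          ((diagonal (fun i => (blockR p₁ p₂ p₃ *ᵥ θ) i ^ α) - blockT T₁₁ T₁₂ T₁₃ T₂₂ T₃₃)⁻¹ *ᵥ
            exitVector (blockT T₁₁ T₁₂ T₁₃ T₂₂ T₃₃)))) :
    HasExplicitForm α π₁ π₂ π₃ T₁₁ T₁₂ T₁₃ T₂₂ T₃₃ μ := by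
  have hT := hparam.isSubIntensity
  have hπ₁ : ∀ i, 0 ≤ π₁ i := fun i => hparam.init_nonneg (Sum.inl i)
  have hπ₂ : ∀ i, 0 ≤ π₂ i := fun i => hparam.init_nonneg (Sum.inr (Sum.inl i))
  have hπ₃ : ∀ i, 0 ≤ π₃ i := fun i => hparam.init_nonneg (Sum.inr (Sum.inr i))
  have hc : 0 ≤ 1 - ∑ i, blockInit π₁ π₂ π₃ i := sub_nonneg.2 hparam.init_sum_le
  have ht := hT.exit_nonneg
  unfold HasExplicitForm
  generalize exitVector (blockT T₁₁ T₁₂ T₁₃ T₂₂ T₃₃) = t at hlap ht ⊢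
  have htt : t = Sum.elim (fun i => t (Sum.inl i))
      (Sum.elim (fun i => t (Sum.inr (Sum.inl i))) fun i => t (Sum.inr (Sum.inr i))) := by
    ext i
    rcases i with i | i | i <;> rfl
  refine ⟨?_, ?_, ?_, ?_, ?_, hc, ?_⟩
  · exact fun x y hy hxy => planeDensity_nonneg hα hα' hT.block₁₁ hT.block₂₂ hπ₁ hT.block₁₂_nonneg
      (fun _ => ht _) hy (sub_pos.2 hxy)
  · exact fun x y hx hxy => planeDensity_nonneg hα hα' hT.block₁₁ hT.block₃₃ hπ₁ hT.block₁₃_nonneg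
      (fun _ => ht _) hx (sub_pos.2 hxy)
  · exact fun x hx => lineDensity_nonneg hα hα' hT.block₁₁ hπ₁ (fun _ => ht _) hx
  · exact fun x hx => lineDensity_nonneg hα hα' hT.block₂₂ hπ₂ (fun _ => ht _) hx
  · exact fun x hx => lineDensity_nonneg hα hα' hT.block₃₃ hπ₃ (fun _ => ht _) hx
  · refine measure_ext_of_laplace hμ (piecewiseMeasure_nonneg _ _ _ _ _ _)
      (fun θ hθ => ?_) fun θ hθ => ?_
    · rw [hlap θ hθ, lintegral_exp_piecewiseMeasure hα hα' hT hπ₁ hπ₂ hπ₃ (fun _ => ht _)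
        (fun _ => ht _) (fun _ => ht _) hc hθ, ← htt]
    · rw [hlap θ hθ]
      exact ENNReal.ofReal_ne_top

theorem IsMPH.hasExplicitForm {α : ℝ} (hα : 0 < α) (hα' : α ≤ 1) {π₁ : Fin p₁ → ℝ}
    {π₂ : Fin p₂ → ℝ} {π₃ : Fin p₃ → ℝ}
    (hparam : IsPHParam (blockInit π₁ π₂ π₃) (blockT T₁₁ T₁₂ T₁₃ T₂₂ T₃₃))
    {μ : Measure (Fin 2 → ℝ)} (hμ : IsMPH α (blockInit π₁ π₂ π₃) (blockT T₁₁ T₁₂ T₁₃ T₂₂ T₃₃)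
      (blockR p₁ p₂ p₃) μ) :
    HasExplicitForm α π₁ π₂ π₃ T₁₁ T₁₂ T₁₃ T₂₂ T₃₃ μ := by
  have := hμ.isProbabilityMeasure
  refine hasExplicitForm_of_laplace hα hα' hparam hμ.nonneg fun θ hθ => ?_
  rw [← hμ.laplace θ fun k => (hθ k).le, ofReal_integral_eq_lintegral_ofReal]
  · refine Integrable.of_bound (C := 1) ?_ ?_
    · have : Measurable fun y : Fin 2 → ℝ => Real.exp (-(y ⬝ᵥ θ)) := by
        simp only [dotProduct]
        fun_prop
      exact this.aestronglyMeasurable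
    · filter_upwards [hμ.nonneg] with y hy
      rw [Real.norm_of_nonneg (Real.exp_nonneg _), Real.exp_le_one_iff, neg_nonpos]
      exact Finset.sum_nonneg fun k _ => mul_nonneg (hy k) (hθ k).le
  · exact Filter.Eventually.of_forall fun y => Real.exp_nonneg _

end Block

/-! ### Pathwise rewards of an absorbed path. -/

section Path

variable {S Ω : Type*} {Z : ℕ → Ω → Option S} {H : ℕ → S → Ω → ℝ} {ω : Ω}

lemma jumpTime_zero : jumpTime Z H 0 ω = 0 := by simp [jumpTime]

lemma jumpTime_succ (n : ℕ) : jumpTime Z H (n + 1) ω =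
    jumpTime Z H n ω + (Z n ω).elim 0 fun i => H n i ω := by
  simp [jumpTime, Finset.sum_range_succ]

/-- The rewards accumulated before the `n`-th jump. -/
noncomputable def partialReward {d : ℕ} (R : Matrix S (Fin d) ℝ) (Z : ℕ → Ω → Option S)
    (H : ℕ → S → Ω → ℝ) (n : ℕ) (ω : Ω) : Fin d → ℝ := fun k =>
  ∑ m ∈ Finset.range n, (Z m ω).elim 0 fun i => R i k * H m i ω

variable (hH : ∀ n i, 0 ≤ H n i ω)
include hH

lemma monotone_jumpTime : Monotone fun n => jumpTime Z H n ω :=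
  monotone_nat_of_le_succ fun n => by
    rw [jumpTime_succ]
    cases Z n ω <;> simp [hH]

/-- The intervals [Sₙ, Sₙ₊₁) are disjoint by monotonicity of the jump times, so the least index
found is the given one, even if some sojourns have length 0. -/
lemma semiMarkov_eq {n : ℕ} {t : ℝ} (h1 : jumpTime Z H n ω ≤ t)
    (h2 : t < jumpTime Z H (n + 1) ω) : semiMarkov Z H t ω = Z n ω := by
  classical
  have hex : ∃ n, jumpTime Z H n ω ≤ t ∧ t < jumpTime Z H (n + 1) ω := ⟨n, h1, h2⟩
  rw [semiMarkov, dif_pos hex]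
  have hfind : Nat.find hex = n := by
    refine le_antisymm (Nat.find_min' hex ⟨h1, h2⟩) (not_lt.1 fun hlt => ?_)
    have h3 := (Nat.find_spec hex).2
    have h4 := monotone_jumpTime (Z := Z) hH (Nat.succ_le_of_lt hlt)
    simp only [Nat.succ_eq_add_one] at h4
    linarith
  convert rfl using 2
  exact hfind.symm

variable {M : ℕ} (hM : ∀ n ≥ M, Z n ω = none)
include hM

omit hH in
lemma jumpTime_eq_of_le {n : ℕ} (hn : M ≤ n) : jumpTime Z H n ω = jumpTime Z H M ω := by
  induction n, hn using Nat.le_induction with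
  | base => rfl
  | succ n hn ih => rw [jumpTime_succ, ih, hM n hn]; simp

lemma semiMarkov_eq_none_iff {t : ℝ} (ht : 0 ≤ t) :
    semiMarkov Z H t ω = none ↔ jumpTime Z H M ω ≤ t := by
  constructor
  · intro h
    by_contra! hlt
    obtain ⟨n, hn1, hn2⟩ : ∃ n, jumpTime Z H n ω ≤ t ∧ t < jumpTime Z H (n + 1) ω := by
      classical
      -- The first jump after t has a positive index, since S₀ = 0 ≤ t; its predecessor starts an
      -- interval that covers t. An interval in the absorbing state has length 0 and cannot do so.
      have hex : ∃ n, t < jumpTime Z H n ω := ⟨M, hlt⟩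
      have h0 : Nat.find hex ≠ 0 := fun h0 => by
        have := Nat.find_spec hex
        rw [h0, jumpTime_zero] at this
        linarith
      obtain ⟨n, hn⟩ := Nat.exists_eq_succ_of_ne_zero h0
      refine ⟨n, not_lt.1 (Nat.find_min hex (m := n) (by omega)), ?_⟩
      have := Nat.find_spec hex
      rwa [hn] at this
    rw [semiMarkov_eq hH hn1 hn2] at h
    rw [jumpTime_succ, h] at hn2
    simp only [Option.elim_none, add_zero] at hn2
    linarith
  · intro h
    rw [semiMarkov, dif_neg]
    rintro ⟨n, -, hn⟩
    have h1 : jumpTime Z H (n + 1) ω ≤ jumpTime Z H M ω := by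
      rcases le_total (n + 1) M with h2 | h2
      · exact monotone_jumpTime hH h2
      · exact (jumpTime_eq_of_le hM h2).le
    linarith

lemma absorptionTime_eq : absorptionTime Z H ω = jumpTime Z H M ω := by
  have h0 : 0 ≤ jumpTime Z H M ω := jumpTime_zero (Z := Z) (H := H) ▸ monotone_jumpTime hH M.zero_le
  have : {t : ℝ | 0 ≤ t ∧ semiMarkov Z H t ω = none} = Set.Ici (jumpTime Z H M ω) := by
    ext t
    constructor
    · exact fun h => (semiMarkov_eq_none_iff hH hM h.1).1 h.2
    · exact fun h => ⟨h0.trans h, (semiMarkov_eq_none_iff hH hM (h0.trans h)).2 h⟩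
  rw [absorptionTime, this, csInf_Ici]

/-- The total reward of an absorbed path is the sum of the rewards of its sojourns. -/
lemma totalReward_eq [Fintype S] {d : ℕ} (R : Matrix S (Fin d) ℝ) :
    totalReward R Z H ω = partialReward R Z H M ω := by
  classical
  ext k
  set f : ℝ → ℝ := fun t => ∑ i, R i k * (if semiMarkov Z H t ω = some i then 1 else 0)
  have hf : ∀ n, ∀ t ∈ Set.Ico (jumpTime Z H n ω) (jumpTime Z H (n + 1) ω),
      f t = (Z n ω).elim 0 fun i => R i k := fun n t ht => by
    simp only [f]
    rw [semiMarkov_eq hH ht.1 ht.2]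
    cases Z n ω <;> simp
  have hle : ∀ n, jumpTime Z H n ω ≤ jumpTime Z H (n + 1) ω := fun n =>
    monotone_jumpTime hH n.le_succ
  have hint : ∀ n < M, IntervalIntegrable f volume (jumpTime Z H n ω) (jumpTime Z H (n + 1) ω) :=
    fun n _ => by
      rw [intervalIntegrable_iff_integrableOn_Ico_of_le (hle n)]
      exact (integrableOn_congr_fun (hf n) measurableSet_Ico).2 (integrableOn_const (by simp))
  have hsum := intervalIntegral.sum_integral_adjacent_intervals hint
  have hgoal : totalReward R Z H ω k = ∫ t in (0 : ℝ)..absorptionTime Z H ω, f t := by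
    simp only [totalReward, f]
  rw [hgoal, absorptionTime_eq hH hM, ← jumpTime_zero (Z := Z) (H := H) (ω := ω), ← hsum,
    partialReward]
  refine Finset.sum_congr rfl fun n _ => ?_
  -- The integrand is constant on [Sₙ, Sₙ₊₁), whereas interval integrals run over (Sₙ, Sₙ₊₁]; the
  -- endpoints are null.
  rw [intervalIntegral.integral_of_le (hle n), integral_Ioc_eq_integral_Ioo,
    ← integral_Ico_eq_integral_Ioo, setIntegral_congr_fun measurableSet_Ico (hf n),
    setIntegral_const, Real.volume_real_Ico_of_le (hle n), jumpTime_succ]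
  cases Z n ω <;> simp [mul_comm]

end Path

/-! ### The embedded chain. -/

section Embedded

variable {S : Type*} [Fintype S] [DecidableEq S] {π : S → ℝ} {T : Matrix S S ℝ}

/-- A zero on the diagonal would leave a row of nonnegative entries with sum at most 0, hence a zero
row, against nonsingularity. -/
lemma IsPHParam.diag_neg (h : IsPHParam π T) (i : S) : T i i < 0 := by
  have h1 := h.exit_nonneg i
  rw [exitVector_apply, ← Finset.add_sum_erase _ _ (Finset.mem_univ i)] at h1
  have h2 : ∀ j ∈ Finset.univ.erase i, 0 ≤ T i j := fun j hj =>
    h.offDiag_nonneg i j (Finset.ne_of_mem_erase hj).symm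
  have h3 := Finset.sum_nonneg h2
  rcases lt_or_eq_of_le (show T i i ≤ 0 by linarith) with h4 | h4
  · exact h4
  · exfalso
    have h5 := (Finset.sum_eq_zero_iff_of_nonneg h2).1 (by linarith)
    refine h.det_ne_zero (det_eq_zero_of_row_eq_zero i fun j => ?_)
    by_cases hj : j = i
    · rw [hj, h4]
    · exact h5 j (Finset.mem_erase.2 ⟨hj, Finset.mem_univ j⟩)

/-- One step of the embedded chain. -/
lemma sum_embedded_some (h : IsPHParam π T) (f : Option S → ℝ) (i : S) :
    ∑ o, embedded T (some i) o * f o =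
      (exitVector T i * f none + ∑ j, T i j * f (some j)) / (-T i i) + f (some i) := by
  have hi := (h.diag_neg i).ne
  rw [Fintype.sum_option]
  -- The chain has no jump from i to i; the diagonal term Tᵢᵢ f(i)/(-Tᵢᵢ) = -f(i) is inserted to
  -- complete the matrix product and compensated by the extra f(i).
  have h1 : ∀ j, embedded T (some i) (some j) * f (some j) =
      T i j * f (some j) / (-T i i) + if i = j then f (some j) else 0 := fun j => by
    simp only [embedded]
    split_ifs with hij
    · subst hij
      field_simp
      ring
    · ring
  simp_rw [h1]
  rw [Finset.sum_add_distrib, Finset.sum_ite_eq, if_pos (Finset.mem_univ i), ← Finset.sum_div]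
  simp only [embedded]
  ring

lemma sum_embedded_none (f : Option S → ℝ) : ∑ o, embedded T none o * f o = f none := by
  rw [Fintype.sum_option]
  simp [embedded]

end Embedded

/-! ### Laplace transform of the sojourn times. -/

section Sojourn

lemma mlDistribution_pos (α l : ℝ) : ∀ᵐ x ∂mlDistribution α l, 0 < x :=
  (withDensity_absolutelyContinuous _ _).ae_le (ae_restrict_mem measurableSet_Ioi)

/-- The scalar Mittag-Leffler law is the 1 × 1 case of the matrix kernel, so its transform is read
off the resolvent. -/
lemma isSubIntensity_unit {l : ℝ} (hl : 0 < l) :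
    IsSubIntensity (diagonal fun _ : Unit => -l) where
  offDiag_nonneg i j hij := absurd (Subsingleton.elim i j) hij
  exit_nonneg i := by simp [exitVector_apply, hl.le]

lemma mittagLeffler_real {α : ℝ} (hα : 0 < α) (l z : ℝ) :
    mittagLeffler α α (-l * z) = mittagLeffler α α (z • diagonal fun _ : Unit => -l) () () := by
  rw [mittagLeffler_smul_apply hα, mittagLeffler]
  refine tsum_congr fun k => ?_
  rw [diagonal_pow, diagonal_apply_eq, smul_eq_mul, mul_pow, mul_assoc]
  rfl

/-- The Laplace transform of the Mittag-Leffler distribution. -/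
lemma lintegral_exp_mlDistribution {α l s : ℝ} (hα : 0 < α) (hα' : α ≤ 1) (hl : 0 < l)
    (hs : 0 < s) : ∫⁻ x, ENNReal.ofReal (Real.exp (-(s * x))) ∂mlDistribution α l =
      ENNReal.ofReal (l / (s ^ α + l)) := by
  have hT := isSubIntensity_unit hl
  have hsα := Real.rpow_pos_of_pos hs α
  have hdens : ∀ x, l * x ^ (α - 1) * mittagLeffler α α (-l * x ^ α) =
      (fun _ : Unit => l) ⬝ᵥ (mlKernel α (diagonal fun _ : Unit => -l) x *ᵥ fun _ => 1) :=
    fun x => by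
      rw [mittagLeffler_real hα]
      simp [dotProduct, mulVec, mlKernel_apply, mul_assoc]
  have hK : kernelLaplace α (diagonal fun _ : Unit => -l) s () () = (s ^ α + l)⁻¹ := by
    have h1 := congrFun (congrFun (hT.diagonal_sub_mul_kernelLaplace hα hα' hs) ()) ()
    rw [diagonal_sub_mul_kernelLaplace_apply] at h1
    simp at h1
    refine eq_inv_of_mul_eq_one_left ?_
    linarith
  have hm : Measurable fun x : ℝ =>
      ENNReal.ofReal (l * x ^ (α - 1) * mittagLeffler α α (-l * x ^ α)) := by
    simp_rw [hdens]
    exact (measurable_dotProduct_mlKernel hα _ _).ennreal_ofReal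
  rw [mlDistribution, lintegral_withDensity_eq_lintegral_mul _ hm (by fun_prop)]
  have := hT.lintegral_mlKernel hα hα' hs (a := fun _ => l) (b := fun _ => 1) (fun _ => hl.le)
    fun _ => zero_le_one
  simp_rw [← hdens] at this
  rw [show l / (s ^ α + l) = (fun _ : Unit => l) ⬝ᵥ
    (kernelLaplace α (diagonal fun _ : Unit => -l) s *ᵥ fun _ => 1) by
      simp [dotProduct, mulVec, hK, div_eq_mul_inv], ← this]
  refine lintegral_congr fun x => ?_
  rw [Pi.mul_apply, mul_comm, ← ENNReal.ofReal_mul (by positivity)]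

lemma integral_exp_mlDistribution {α l s : ℝ} (hα : 0 < α) (hα' : α ≤ 1) (hl : 0 < l)
    (hs : 0 < s) : ∫ x, Real.exp (-(s * x)) ∂mlDistribution α l = l / (s ^ α + l) := by
  have hsα := Real.rpow_pos_of_pos hs α
  rw [integral_eq_lintegral_of_nonneg_ae (Filter.Eventually.of_forall fun _ => Real.exp_nonneg _)
    (by fun_prop : Measurable fun x : ℝ => Real.exp (-(s * x))).aestronglyMeasurable,
    lintegral_exp_mlDistribution hα hα' hl hs, ENNReal.toReal_ofReal (by positivity)]

end Sojourn

lemma integral_eq_sum_setIntegral {Ω ι : Type*} [MeasurableSpace Ω] {P : Measure Ω} [Fintype ι]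
    {W : Ω → ι} (hW : ∀ i, MeasurableSet {ω | W ω = i}) {X : Ω → ℝ} (hX : Integrable X P) :
    ∫ ω, X ω ∂P = ∑ i, ∫ ω in {ω | W ω = i}, X ω ∂P := by
  classical
  simp_rw [← integral_indicator (hW _)]
  rw [← integral_finsetSum _ fun i _ => hX.indicator (hW i)]
  refine integral_congr_ae (Filter.Eventually.of_forall fun ω => ?_)
  simp [Set.indicator_apply]

/-! ### The semi-Markov model and the Laplace transform of its rewards. -/

section Model

variable {S : Type*}

/-- The factor that a sojourn contributes to the exponential of the rewards with rates `r`. -/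
noncomputable def sojournWeight {Ω : Type*} (r : S → ℝ) (H : ℕ → S → Ω → ℝ) (m : ℕ) (o : Option S)
    (ω : Ω) : ℝ :=
  o.elim 1 fun i => Real.exp (-(r i * H m i ω))

/-- The infinite path that continues a finite one in the absorbing state. -/
def extendPath {n : ℕ} (z : Fin (n + 1) → Option S) (m : ℕ) : Option S :=
  if h : m < n + 1 then z ⟨m, h⟩ else none

lemma path_eq_iff {n : ℕ} (z : Fin (n + 1) → Option S) (y : ℕ → Option S) :
    (fun m : Fin (n + 1) => y m) = z ↔ ∀ m ≤ n, y m = extendPath z m := by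
  rw [funext_iff]
  constructor
  · intro h m hm
    rw [extendPath, dif_pos (Nat.lt_succ_of_le hm)]
    exact h ⟨m, _⟩
  · intro h m
    rw [h m (Nat.le_of_lt_succ m.2), extendPath, dif_pos m.2]

variable [Fintype S] [DecidableEq S] {α : ℝ} {π : S → ℝ} {T : Matrix S S ℝ} {Ω : Type*}
  [MeasurableSpace Ω] {P : Measure Ω} {Z : ℕ → Ω → Option S} {H : ℕ → S → Ω → ℝ}

namespace IsSemiMarkovModel

variable (hM : IsSemiMarkovModel α π T P Z H)
include hM

lemma measurableSet_chain_eq (n : ℕ) (o : Option S) : MeasurableSet {ω | Z n ω = o} :=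
  hM.measurable_chain n (MeasurableSpace.measurableSet_top (s := {o}))

lemma measurable_comp_chain (n : ℕ) {F : Option S → Ω → ℝ} (hF : ∀ o, Measurable (F o)) :
    Measurable fun ω => F (Z n ω) ω := by
  intro B hB
  have : (fun ω => F (Z n ω) ω) ⁻¹' B = ⋃ o, {ω | Z n ω = o} ∩ F o ⁻¹' B := by
    ext ω
    simp
  rw [this]
  exact MeasurableSet.iUnion fun o => (hM.measurableSet_chain_eq n o).inter (hF o hB)

lemma measurable_sojournWeight (r : S → ℝ) (m : ℕ) (o : Option S) :
    Measurable (sojournWeight r H m o) := by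
  cases o with
  | none => exact measurable_const
  | some i => exact ((hM.measurable_sojourn m i).const_mul (r i)).neg.exp

lemma sojourn_nonneg : ∀ᵐ ω ∂P, ∀ n i, 0 ≤ H n i ω := by
  simp only [ae_all_iff]
  intro n i
  have h1 := mlDistribution_pos α (-T i i)
  rw [← (hM.sojourn_law n i).map_eq] at h1
  filter_upwards [ae_of_ae_map (hM.measurable_sojourn n i).aemeasurable h1] with ω hω using hω.le

lemma integral_exp_sojourn (hparam : IsPHParam π T) (hα : 0 < α) (hα' : α ≤ 1) {s : ℝ}
    (hs : 0 < s) (m : ℕ) (i : S) :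
    ∫ ω, Real.exp (-(s * H m i ω)) ∂P = -T i i / (s ^ α + -T i i) := by
  rw [← integral_exp_mlDistribution hα hα' (neg_pos.2 (hparam.diag_neg i)) hs]
  exact (hM.sojourn_law m i).integral_comp (f := fun x => Real.exp (-(s * x)))
    (by fun_prop : Measurable fun x : ℝ => Real.exp (-(s * x))).aestronglyMeasurable

lemma integral_prod_sojournWeight {r w : S → ℝ}
    (hw : ∀ m i, ∫ ω, Real.exp (-(r i * H m i ω)) ∂P = w i) (k : ℕ) (z : ℕ → Option S) :
    ∫ ω, ∏ m ∈ Finset.range k, sojournWeight r H m (z m) ω ∂P =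
      ∏ m ∈ Finset.range k, (z m).elim 1 w := by
  have := hM.isProbabilityMeasure
  rcases isEmpty_or_nonempty S with hS | ⟨⟨i₀⟩⟩
  · have hz : ∀ m, z m = none := fun m => by
      cases h : z m with
      | none => rfl
      | some i => exact (hS.false i).elim
    simp [hz, sojournWeight]
  -- Along a fixed path the sojourns used carry distinct indices (m, state), hence are independent.
  -- The default `i₀` fills in a state at times spent in the absorbing state, where the weight is
  -- constantly 1.
  · have hind := (hM.sojourn_indep.precomp (g := fun m : Fin k => ((m : ℕ), (z m).getD i₀))
      fun a b h => Fin.ext (Prod.ext_iff.1 h).1).comp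
      (fun m x => (z m).elim 1 fun i => Real.exp (-(r i * x))) fun m => by
        cases z m with
        | none => exact measurable_const
        | some i =>
          simp only [Option.elim_some]
          fun_prop
    have heq : ∀ m : Fin k, (fun x => (z m).elim 1 fun i => Real.exp (-(r i * x))) ∘
        H m ((z m).getD i₀) = sojournWeight r H m (z m) := fun m => by
      ext ω
      simp only [Function.comp_apply, sojournWeight]
      cases z m <;> simp
    simp only [heq] at hind
    simp only [← Fin.prod_univ_eq_prod_range]
    rw [hind.integral_fun_prod_eq_prod_integral fun m =>
      (hM.measurable_sojournWeight r m (z m)).aestronglyMeasurable]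
    refine Finset.prod_congr rfl fun m _ => ?_
    simp only [sojournWeight]
    cases z m <;> simp [hw]

/-- The event concerns only the chain and the product only the sojourns, so independence factorises
the integral into the path probability and the transforms of the sojourns. -/
lemma setIntegral_path {r w : S → ℝ}
    (hw : ∀ m i, ∫ ω, Real.exp (-(r i * H m i ω)) ∂P = w i) (n k : ℕ) (z : ℕ → Option S) :
    ∫ ω in {ω | ∀ m ≤ n, Z m ω = z m}, ∏ m ∈ Finset.range k, sojournWeight r H m (z m) ω ∂P =
      (initial π (z 0) * ∏ m ∈ Finset.range n, embedded T (z m) (z (m + 1))) *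
        ∏ m ∈ Finset.range k, (z m).elim 1 w := by
  have := hM.isProbabilityMeasure
  set X : Ω → ℕ × S → ℝ := fun ω q => H q.1 q.2 ω
  have hX : Measurable X := measurable_pi_lambda _ fun q => hM.measurable_sojourn q.1 q.2
  have hind : Indep (⨆ n, MeasurableSpace.comap (Z n) ⊤)
      (MeasurableSpace.comap X inferInstance) P := by
    have h1 : MeasurableSpace.comap X inferInstance =
        ⨆ q : ℕ × S, MeasurableSpace.comap (H q.1 q.2) inferInstance := by
      change MeasurableSpace.comap X (⨆ q, MeasurableSpace.comap _ _) = _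
      rw [MeasurableSpace.comap_iSup]
      simp_rw [MeasurableSpace.comap_comp]
      rfl
    rw [h1]
    exact hM.chain_indep
  have hle : (⨆ n, MeasurableSpace.comap (Z n) ⊤) ≤ (inferInstance : MeasurableSpace Ω) :=
    iSup_le fun n => (hM.measurable_chain n).comap_le
  have hA : MeasurableSet[⨆ n, MeasurableSpace.comap (Z n) ⊤] {ω | ∀ m ≤ n, Z m ω = z m} := by
    simp only [Set.ofPred_forall]
    refine MeasurableSet.iInter fun m => MeasurableSet.iInter fun _ => ?_
    exact (le_iSup (fun n => MeasurableSpace.comap (Z n) ⊤) m) _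
      ⟨{z m}, MeasurableSpace.measurableSet_top, rfl⟩
  have hf : Measurable fun x : ℕ × S → ℝ => ∏ m ∈ Finset.range k,
      (z m).elim 1 fun i => Real.exp (-(r i * x (m, i))) := by
    refine Finset.measurable_fun_prod _ fun m _ => ?_
    cases z m with
    | none => exact measurable_const
    | some i =>
      simp only [Option.elim_some]
      fun_prop
  have key := Indep.setIntegral_eq_smul hle hind hX.aemeasurable hA
    (hf.aestronglyMeasurable (μ := P.map X))
  rw [hM.markov, smul_eq_mul] at key
  rw [← hM.integral_prod_sojournWeight hw k z]
  exact key

lemma integrable_prod_mul {r : S → ℝ} (hr : ∀ i, 0 ≤ r i) (f : Option S → ℝ) (k n : ℕ) :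
    Integrable (fun ω => (∏ m ∈ Finset.range k, sojournWeight r H m (Z m ω) ω) * f (Z n ω)) P := by
  have := hM.isProbabilityMeasure
  refine Integrable.of_bound (C := ∑ o, |f o|) ?_ ?_
  · exact ((Finset.measurable_fun_prod _ fun m _ => hM.measurable_comp_chain m fun o =>
      hM.measurable_sojournWeight r m o).mul (hM.measurable_comp_chain n fun o =>
        measurable_const)).aestronglyMeasurable
  · filter_upwards [hM.sojourn_nonneg] with ω hω
    have h1 : ∀ m o, 0 ≤ sojournWeight r H m o ω := fun m o => by
      cases o <;> simp [sojournWeight, Real.exp_nonneg]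
    have h2 : ∀ m o, sojournWeight r H m o ω ≤ 1 := fun m o => by
      cases o with
      | none => simp [sojournWeight]
      | some i => simpa [sojournWeight] using mul_nonneg (hr i) (hω m i)
    rw [norm_mul, Real.norm_of_nonneg (Finset.prod_nonneg fun m _ => h1 m _), Real.norm_eq_abs]
    calc _ ≤ 1 * |f (Z n ω)| := by
          gcongr
          exact Finset.prod_le_one (fun m _ => h1 m _) fun m _ => h2 m _
      _ ≤ _ := by
          rw [one_mul]
          exact Finset.single_le_sum (f := fun o => |f o|) (fun _ _ => abs_nonneg _)
            (Finset.mem_univ _)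

/-- The Markov property, with exponential weights of the sojourns. -/
lemma integral_step {r w : S → ℝ} (hr : ∀ i, 0 ≤ r i)
    (hw : ∀ m i, ∫ ω, Real.exp (-(r i * H m i ω)) ∂P = w i) (f : Option S → ℝ) (n : ℕ) :
    ∫ ω, (∏ m ∈ Finset.range (n + 1), sojournWeight r H m (Z m ω) ω) * f (Z (n + 1) ω) ∂P =
      ∫ ω, (∏ m ∈ Finset.range n, sojournWeight r H m (Z m ω) ω) *
        ((Z n ω).elim 1 w * ∑ o, embedded T (Z n ω) o * f o) ∂P := by
  have hpath : ∀ z : Fin (n + 1) → Option S, {ω | (fun m : Fin (n + 1) => Z m ω) = z} =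
      {ω | ∀ m ≤ n, Z m ω = extendPath z m} := fun z => by
    ext ω
    exact path_eq_iff z fun m => Z m ω
  have hpath_meas : ∀ z : Fin (n + 1) → Option S,
      MeasurableSet {ω | (fun m : Fin (n + 1) => Z m ω) = z} := fun z => by
    simp only [funext_iff, Set.ofPred_forall]
    exact MeasurableSet.iInter fun m => hM.measurableSet_chain_eq m _
  have hpair : ∀ a : (Fin (n + 1) → Option S) × Option S,
      {ω | ((fun m : Fin (n + 1) => Z m ω), Z (n + 1) ω) = a} =
      {ω | ∀ m ≤ n + 1, Z m ω = Function.update (extendPath a.1) (n + 1) a.2 m} := fun a => by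
    ext ω
    simp only [Prod.ext_iff, Set.mem_ofPred_eq]
    rw [path_eq_iff a.1 fun m => Z m ω]
    constructor
    · rintro ⟨h1, h2⟩ m hm
      rcases Nat.lt_or_eq_of_le hm with h | h
      · rw [Function.update_of_ne h.ne]
        exact h1 m (Nat.le_of_lt_succ h)
      · rw [h, Function.update_self, h2]
    · intro h
      refine ⟨fun m hm => ?_, ?_⟩
      · rw [h m (by omega), Function.update_of_ne (by omega)]
      · rw [h _ le_rfl, Function.update_self]
  have hpair_meas : ∀ a : (Fin (n + 1) → Option S) × Option S,
      MeasurableSet {ω | ((fun m : Fin (n + 1) => Z m ω), Z (n + 1) ω) = a} := fun a => by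
    simp only [Prod.ext_iff, Set.ofPred_and]
    exact (hpath_meas a.1).inter (hM.measurableSet_chain_eq _ _)
  -- There are finitely many paths up to time n. The left side is also split by the state at time n
  -- + 1; on each cell the chain is frozen, and summing out that last state produces one step of the
  -- transition matrix.
  rw [integral_eq_sum_setIntegral hpair_meas (hM.integrable_prod_mul hr f (n + 1) (n + 1)),
    integral_eq_sum_setIntegral hpath_meas (hM.integrable_prod_mul hr
      (fun o => o.elim 1 w * ∑ o', embedded T o o' * f o') n n), Fintype.sum_prod_type]
  refine Finset.sum_congr rfl fun z _ => ?_
  set e := extendPath z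
  have hR : ∫ ω in {ω | (fun m : Fin (n + 1) => Z m ω) = z},
      (∏ m ∈ Finset.range n, sojournWeight r H m (Z m ω) ω) *
        ((Z n ω).elim 1 w * ∑ o, embedded T (Z n ω) o * f o) ∂P =
      ((initial π (e 0) * ∏ m ∈ Finset.range n, embedded T (e m) (e (m + 1))) *
        ∏ m ∈ Finset.range n, (e m).elim 1 w) *
        ((e n).elim 1 w * ∑ o, embedded T (e n) o * f o) := by
    rw [← hM.setIntegral_path hw n n e, ← integral_mul_const]
    have hms := hpath_meas z
    rw [hpath] at hms ⊢
    refine setIntegral_congr_fun hms fun ω hω => ?_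
    rw [hω n le_rfl]
    congr 1
    exact Finset.prod_congr rfl fun m hm => by rw [hω m (Finset.mem_range.1 hm).le]
  have hL : ∀ o, ∫ ω in {ω | ((fun m : Fin (n + 1) => Z m ω), Z (n + 1) ω) = (z, o)},
      (∏ m ∈ Finset.range (n + 1), sojournWeight r H m (Z m ω) ω) * f (Z (n + 1) ω) ∂P =
      ((initial π (e 0) * ((∏ m ∈ Finset.range n, embedded T (e m) (e (m + 1))) *
        embedded T (e n) o)) * ((∏ m ∈ Finset.range n, (e m).elim 1 w) * (e n).elim 1 w)) *
        f o := fun o => by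
    set y := Function.update e (n + 1) o with hy
    have hy0 : ∀ m, m ≤ n → y m = e m := fun m hm => Function.update_of_ne (by omega) _ _
    have hy1 : y (n + 1) = o := Function.update_self _ _ _
    have h1 : ∏ m ∈ Finset.range (n + 1), embedded T (y m) (y (m + 1)) =
        (∏ m ∈ Finset.range n, embedded T (e m) (e (m + 1))) * embedded T (e n) o := by
      rw [Finset.prod_range_succ, hy0 n le_rfl, hy1]
      congr 1
      exact Finset.prod_congr rfl fun m hm => by
        have := Finset.mem_range.1 hm
        rw [hy0 m (by omega), hy0 (m + 1) (by omega)]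
    have h2 : ∏ m ∈ Finset.range (n + 1), (y m).elim 1 w =
        (∏ m ∈ Finset.range n, (e m).elim 1 w) * (e n).elim 1 w := by
      rw [Finset.prod_range_succ, hy0 n le_rfl]
      congr 1
      exact Finset.prod_congr rfl fun m hm => by rw [hy0 m (Finset.mem_range.1 hm).le]
    rw [← h1, ← h2, ← hy0 0 n.zero_le, ← hM.setIntegral_path hw (n + 1) (n + 1) y,
      ← integral_mul_const]
    have hms := hpair_meas (z, o)
    rw [hpair] at hms ⊢
    refine setIntegral_congr_fun hms fun ω hω => ?_
    rw [hω (n + 1) le_rfl]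
    simp only [← hy, e, hy1]
    congr 1
    exact Finset.prod_congr rfl fun m hm => by rw [hω m (Finset.mem_range.1 hm).le]
  rw [hR, Finset.sum_congr rfl fun o _ => hL o, Finset.mul_sum, Finset.mul_sum]
  exact Finset.sum_congr rfl fun o _ => by ring

lemma integral_chain_zero (f : Option S → ℝ) :
    ∫ ω, f (Z 0 ω) ∂P = ∑ o, initial π o * f o := by
  have := hM.isProbabilityMeasure
  have hint : Integrable (fun ω => f (Z 0 ω)) P := by
    simpa using hM.integrable_prod_mul (r := 0) (fun _ => le_rfl) f 0 0
  rw [integral_eq_sum_setIntegral (hM.measurableSet_chain_eq 0) hint]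
  refine Finset.sum_congr rfl fun o _ => ?_
  have h1 := hM.markov 0 fun _ => o
  simp only [Nat.le_zero, forall_eq, Finset.range_zero, Finset.prod_empty, mul_one] at h1
  rw [setIntegral_congr_fun (g := fun _ => f o) (hM.measurableSet_chain_eq 0 o)
    fun ω hω => congrArg f hω, setIntegral_const, h1, smul_eq_mul]

/-- The chain is absorbed almost surely. -/
lemma eventually_absorbed (hparam : IsPHParam π T) :
    ∀ᵐ ω ∂P, ∀ᶠ n in Filter.atTop, Z n ω = none := by
  have := hM.isProbabilityMeasure
  -- the expected numbers of visits are bounded by a telescoping sum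
  set g₀ : S → ℝ := T⁻¹ *ᵥ fun _ => -1
  have hg₀ : ∀ i, ∑ j, T i j * g₀ j = -1 := fun i => by
    have h1 : T *ᵥ g₀ = fun _ => -1 := by
      rw [mulVec_mulVec, mul_nonsing_inv _ (isUnit_iff_ne_zero.2 hparam.det_ne_zero), one_mulVec]
    exact congrFun h1 i
  set g : Option S → ℝ := fun o => o.elim 0 g₀
  set c : Option S → ℝ := fun o => o.elim 0 fun i => (-T i i)⁻¹
  have hc0 : ∀ o, 0 ≤ c o := fun o => by
    cases o with
    | none => exact le_rfl
    | some i => exact inv_nonneg.2 (neg_nonneg.2 (hparam.diag_neg i).le)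
  have hint : ∀ (f : Option S → ℝ) n, Integrable (fun ω => f (Z n ω)) P := fun f n => by
    simpa using hM.integrable_prod_mul (r := 0) (fun _ => le_rfl) f 0 n
  -- From T g₀ = -e, one step lowers g by c exactly. For α = 1, g is the mean remaining time to
  -- absorption and c the mean holding time; only the algebra is used here.
  have hQ : ∀ o, (o.elim 1 fun _ => 1) * ∑ o', embedded T o o' * g o' = g o - c o := fun o => by
    cases o with
    | none => rw [sum_embedded_none]; simp [g, c]
    | some i =>
      rw [sum_embedded_some hparam]
      simp only [g, c, Option.elim_some, Option.elim_none, hg₀]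
      have := (hparam.diag_neg i).ne
      field_simp
      ring
  have hstep : ∀ n, ∫ ω, g (Z (n + 1) ω) ∂P = ∫ ω, g (Z n ω) ∂P - ∫ ω, c (Z n ω) ∂P := fun n => by
    have h1 := hM.integral_step (r := 0) (w := fun _ => 1) (fun _ => le_rfl) (by simp) g n
    have h2 : ∀ m o ω, sojournWeight 0 H m o ω = 1 := fun m o ω => by
      cases o <;> simp [sojournWeight]
    simp only [h2, Finset.prod_const_one, one_mul, hQ] at h1
    rw [h1, integral_sub (hint g n) (hint c n)]
  have htel : ∀ N, ∑ n ∈ Finset.range N, ∫ ω, c (Z n ω) ∂P =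
      ∫ ω, g (Z 0 ω) ∂P - ∫ ω, g (Z N ω) ∂P := fun N => by
    rw [← Finset.sum_range_sub' fun n => ∫ ω, g (Z n ω) ∂P]
    exact Finset.sum_congr rfl fun n _ => by rw [hstep]; ring
  have hsummable : Summable fun n => ∫ ω, c (Z n ω) ∂P := by
    refine summable_of_sum_range_le (c := ∫ ω, g (Z 0 ω) ∂P + ∑ o, |g o|)
      (fun n => integral_nonneg fun ω => hc0 _) fun N => ?_
    have h1 : -∑ o, |g o| ≤ ∫ ω, g (Z N ω) ∂P := by
      have h2 : ∫ _, (-∑ o, |g o|) ∂P ≤ ∫ ω, g (Z N ω) ∂P := by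
        refine integral_mono (integrable_const _) (hint g N) fun ω => ?_
        refine (neg_le_neg ?_).trans (neg_abs_le (g (Z N ω)))
        exact Finset.single_le_sum (f := fun o => |g o|) (fun _ _ => abs_nonneg _)
          (Finset.mem_univ _)
      simpa using h2
    rw [htel]
    linarith
  -- Borel–Cantelli: P(Zₙ = i) is at most λᵢ E c(Zₙ), which is summable.
  have hi : ∀ i, ∀ᵐ ω ∂P, ∀ᶠ n in Filter.atTop, ¬ Z n ω = some i := fun i => by
    refine ae_eventually_notMem (s := fun n => {ω | Z n ω = some i}) ?_
    have hl := neg_pos.2 (hparam.diag_neg i)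
    have hb : ∀ n, P {ω | Z n ω = some i} ≤ ENNReal.ofReal (-T i i * ∫ ω, c (Z n ω) ∂P) :=
      fun n => by
        rw [← ofReal_measureReal]
        refine ENNReal.ofReal_le_ofReal ?_
        rw [← integral_const_mul, ← integral_indicator_one (hM.measurableSet_chain_eq n (some i))]
        refine integral_mono ((integrable_const (1 : ℝ)).indicator
          (hM.measurableSet_chain_eq n (some i))) ((hint c n).const_mul _) fun ω => ?_
        by_cases hω : Z n ω = some i
        · rw [Set.indicator_of_mem (show ω ∈ {ω | Z n ω = some i} from hω)]
          simp only [hω, c, Option.elim_some, Pi.one_apply]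
          rw [mul_inv_cancel₀ hl.ne']
        · rw [Set.indicator_of_notMem (show ω ∉ {ω | Z n ω = some i} from hω)]
          exact mul_nonneg hl.le (hc0 _)
    refine ne_top_of_le_ne_top ?_ (ENNReal.tsum_le_tsum hb)
    exact (hsummable.mul_left _).tsum_ofReal_ne_top
  filter_upwards [ae_all_iff.2 hi] with ω hω
  filter_upwards [Filter.eventually_all.2 hω] with n hn
  cases h : Z n ω with
  | none => rfl
  | some i => exact (hn i h).elim

variable {d : ℕ} (R : Matrix S (Fin d) ℝ)

lemma eventually_totalReward_eq (hparam : IsPHParam π T) :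
    ∀ᵐ ω ∂P, ∀ᶠ n in Filter.atTop, Z n ω = none ∧
      totalReward R Z H ω = partialReward R Z H n ω := by
  filter_upwards [hM.eventually_absorbed hparam, hM.sojourn_nonneg] with ω h1 h2
  obtain ⟨M, hM⟩ := Filter.eventually_atTop.1 h1
  filter_upwards [Filter.eventually_ge_atTop M] with n hn
  exact ⟨hM n hn, totalReward_eq h2 (M := n) (fun m hm => hM m (hn.trans hm)) R⟩

lemma measurable_partialReward (n : ℕ) : Measurable (partialReward R Z H n) := by
  refine measurable_pi_lambda _ fun k => Finset.measurable_fun_sum _ fun m _ =>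
    hM.measurable_comp_chain m (F := fun o ω => o.elim 0 fun i => R i k * H m i ω) fun o => ?_
  cases o with
  | none => exact measurable_const
  | some i => exact (hM.measurable_sojourn m i).const_mul _

/-- The total reward is defined pathwise through an infimum and an integral; it is almost surely the
eventual value of the measurable partial rewards. -/
lemma aemeasurable_totalReward (hparam : IsPHParam π T) : AEMeasurable (totalReward R Z H) P := by
  refine aemeasurable_of_tendsto_metrizable_ae Filter.atTop
    (fun n => (hM.measurable_partialReward R n).aemeasurable) ?_
  filter_upwards [hM.eventually_totalReward_eq R hparam] with ω hω
  refine tendsto_const_nhds.congr' ?_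
  filter_upwards [hω] with n hn using hn.2

lemma totalReward_nonneg (hparam : IsPHParam π T) (hR : ∀ i k, 0 ≤ R i k) :
    ∀ᵐ ω ∂P, ∀ k, 0 ≤ totalReward R Z H ω k := by
  filter_upwards [hM.eventually_totalReward_eq R hparam, hM.sojourn_nonneg] with ω hω hH k
  obtain ⟨n, -, hn⟩ := hω.exists
  rw [hn]
  refine Finset.sum_nonneg fun m _ => ?_
  cases Z m ω with
  | none => exact le_rfl
  | some i => exact mul_nonneg (hR i k) (hH m i)

omit hM [Fintype S] [DecidableEq S] [MeasurableSpace Ω] in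
lemma exp_neg_partialReward (θ : Fin d → ℝ) (n : ℕ) (ω : Ω) :
    Real.exp (-(partialReward R Z H n ω ⬝ᵥ θ)) =
      ∏ m ∈ Finset.range n, sojournWeight (R *ᵥ θ) H m (Z m ω) ω := by
  have h1 : -(partialReward R Z H n ω ⬝ᵥ θ) =
      ∑ m ∈ Finset.range n, (Z m ω).elim 0 fun i => -((R *ᵥ θ) i * H m i ω) := by
    simp only [partialReward, dotProduct, Finset.sum_mul]
    rw [Finset.sum_comm, ← Finset.sum_neg_distrib]
    refine Finset.sum_congr rfl fun m _ => ?_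
    cases Z m ω with
    | none => simp
    | some i =>
      simp only [Option.elim_some, mulVec, dotProduct, Finset.sum_mul]
      congr 1
      exact Finset.sum_congr rfl fun k _ => by ring
  rw [h1, Real.exp_sum]
  refine Finset.prod_congr rfl fun m _ => ?_
  cases Z m ω <;> simp [sojournWeight]

/-- The Laplace transform of the total rewards. -/
lemma integral_exp_neg_totalReward (hparam : IsPHParam π T) (hα : 0 < α) (hα' : α ≤ 1)
    {θ : Fin d → ℝ} (hθ : ∀ i, 0 < (R *ᵥ θ) i) :
    Integrable (fun ω => Real.exp (-(totalReward R Z H ω ⬝ᵥ θ))) P ∧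
    ∫ ω, Real.exp (-(totalReward R Z H ω ⬝ᵥ θ)) ∂P = (1 - ∑ i, π i) +
      π ⬝ᵥ ((diagonal (fun i => (R *ᵥ θ) i ^ α) - T)⁻¹ *ᵥ exitVector T) := by
  have := hM.isProbabilityMeasure
  set r := R *ᵥ θ
  set D : S → ℝ := fun i => r i ^ α
  have hD : ∀ i, 0 < D i := fun i => Real.rpow_pos_of_pos (hθ i) α
  set x := (diagonal D - T)⁻¹ *ᵥ exitVector T with hx
  have hxs : ∀ i, D i * x i - ∑ j, T i j * x j = exitVector T i := fun i => by
    rw [← diagonal_sub_mulVec, hx, mulVec_mulVec, mul_nonsing_inv _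
      (isUnit_iff_ne_zero.2 (hparam.isSubIntensity.det_ne_zero hD)), one_mulVec]
  -- `h` is harmonic for the weighted chain
  set h : Option S → ℝ := fun o => o.elim 1 x
  set w : S → ℝ := fun i => -T i i / (D i + -T i i)
  -- With λ = -Tᵢᵢ and t + Tx = Dx from `hxs`, the transient case reads λ/(D + λ) · (Dx/λ + x) = x.
  have hharm : ∀ o, o.elim 1 w * ∑ o', embedded T o o' * h o' = h o := fun o => by
    cases o with
    | none => rw [sum_embedded_none]; simp [h]
    | some i =>
      rw [sum_embedded_some hparam]
      simp only [h, w, Option.elim_some, Option.elim_none]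
      have h1 := (hparam.diag_neg i).ne
      have h2 : D i + -T i i ≠ 0 := (add_pos (hD i) (neg_pos.2 (hparam.diag_neg i))).ne'
      rw [← hxs i]
      field_simp
      ring
  have hr : ∀ i, 0 ≤ r i := fun i => (hθ i).le
  have hw : ∀ m i, ∫ ω, Real.exp (-(r i * H m i ω)) ∂P = w i := fun m i =>
    hM.integral_exp_sojourn hparam hα hα' (hθ i) m i
  have hconst : ∀ n, ∫ ω, (∏ m ∈ Finset.range n, sojournWeight r H m (Z m ω) ω) * h (Z n ω) ∂P =
      (1 - ∑ i, π i) + π ⬝ᵥ x := fun n => by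
    induction n with
    | zero =>
      simp only [Finset.range_zero, Finset.prod_empty, one_mul]
      rw [hM.integral_chain_zero, Fintype.sum_option]
      simp [initial, h, dotProduct]
    | succ n ih =>
      rw [hM.integral_step hr hw, ← ih]
      simp_rw [hharm]
  -- After absorption h equals 1 and the product of the weights no longer changes, so the sequence
  -- is eventually constant.
  have hlim : ∀ᵐ ω ∂P, Filter.Tendsto
      (fun n => (∏ m ∈ Finset.range n, sojournWeight r H m (Z m ω) ω) * h (Z n ω)) Filter.atTop
      (nhds (Real.exp (-(totalReward R Z H ω ⬝ᵥ θ)))) := by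
    filter_upwards [hM.eventually_totalReward_eq R hparam] with ω hω
    refine tendsto_const_nhds.congr' ?_
    filter_upwards [hω] with n hn
    rw [hn.2, hn.1, exp_neg_partialReward]
    simp [h, r]
  have hmeas : AEStronglyMeasurable (fun ω => Real.exp (-(totalReward R Z H ω ⬝ᵥ θ))) P := by
    have h1 : Measurable fun y : Fin d → ℝ => Real.exp (-(y ⬝ᵥ θ)) := by
      simp only [dotProduct]
      fun_prop
    exact (h1.comp_aemeasurable (hM.aemeasurable_totalReward R hparam)).aestronglyMeasurable
  have hweight : ∀ᵐ ω ∂P, ∀ n, 0 ≤ (∏ m ∈ Finset.range n, sojournWeight r H m (Z m ω) ω) ∧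
      (∏ m ∈ Finset.range n, sojournWeight r H m (Z m ω) ω) ≤ 1 := by
    filter_upwards [hM.sojourn_nonneg] with ω hω n
    have h1 : ∀ m o, 0 ≤ sojournWeight r H m o ω := fun m o => by
      cases o <;> simp [sojournWeight, Real.exp_nonneg]
    have h2 : ∀ m o, sojournWeight r H m o ω ≤ 1 := fun m o => by
      cases o with
      | none => simp [sojournWeight]
      | some i => simpa [sojournWeight] using mul_nonneg (hr i) (hω m i)
    exact ⟨Finset.prod_nonneg fun m _ => h1 m _, Finset.prod_le_one (fun m _ => h1 m _)
      fun m _ => h2 m _⟩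
  refine ⟨?_, ?_⟩
  · refine Integrable.of_bound hmeas 1 ?_
    filter_upwards [hM.eventually_totalReward_eq R hparam, hweight] with ω hω hω'
    obtain ⟨n, -, hn⟩ := hω.exists
    rw [Real.norm_of_nonneg (Real.exp_nonneg _), hn, exp_neg_partialReward]
    exact (hω' n).2
  · have hdct := tendsto_integral_of_dominated_convergence (fun _ => ∑ o, |h o|)
      (fun n => (hM.integrable_prod_mul hr h n n).1) (integrable_const _) (fun n => ?_) hlim
    · simp_rw [hconst] at hdct
      exact tendsto_nhds_unique hdct tendsto_const_nhds
    · filter_upwards [hweight] with ω hω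
      rw [norm_mul, Real.norm_of_nonneg (hω n).1, Real.norm_eq_abs]
      calc _ ≤ 1 * |h (Z n ω)| := by
            gcongr
            exact (hω n).2
        _ ≤ _ := by
            rw [one_mul]
            exact Finset.single_le_sum (f := fun o => |h o|) (fun _ _ => abs_nonneg _)
              (Finset.mem_univ _)

end IsSemiMarkovModel

end Model

lemma blockR_nonneg (p₁ p₂ p₃ : ℕ) (i : Fin p₁ ⊕ (Fin p₂ ⊕ Fin p₃)) (k : Fin 2) :
    0 ≤ blockR p₁ p₂ p₃ i k := by
  rcases i with i | i | i <;> fin_cases k <;> simp [blockR]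

theorem IsSemiMarkovModel.hasExplicitForm {p₁ p₂ p₃ : ℕ} {α : ℝ} (hα : 0 < α) (hα' : α ≤ 1)
    {π₁ : Fin p₁ → ℝ} {π₂ : Fin p₂ → ℝ} {π₃ : Fin p₃ → ℝ}
    {T₁₁ : Matrix (Fin p₁) (Fin p₁) ℝ} {T₁₂ : Matrix (Fin p₁) (Fin p₂) ℝ}
    {T₁₃ : Matrix (Fin p₁) (Fin p₃) ℝ} {T₂₂ : Matrix (Fin p₂) (Fin p₂) ℝ}
    {T₃₃ : Matrix (Fin p₃) (Fin p₃) ℝ}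
    (hparam : IsPHParam (blockInit π₁ π₂ π₃) (blockT T₁₁ T₁₂ T₁₃ T₂₂ T₃₃))
    {Ω : Type*} [MeasurableSpace Ω] {P : Measure Ω}
    {Z : ℕ → Ω → Option (Fin p₁ ⊕ (Fin p₂ ⊕ Fin p₃))}
    {H : ℕ → Fin p₁ ⊕ (Fin p₂ ⊕ Fin p₃) → Ω → ℝ}
    (hM : IsSemiMarkovModel α (blockInit π₁ π₂ π₃) (blockT T₁₁ T₁₂ T₁₃ T₂₂ T₃₃) P Z H) :
    HasExplicitForm α π₁ π₂ π₃ T₁₁ T₁₂ T₁₃ T₂₂ T₃₃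
      (P.map (totalReward (blockR p₁ p₂ p₃) Z H)) := by
  have hY := hM.aemeasurable_totalReward (blockR p₁ p₂ p₃) hparam
  refine hasExplicitForm_of_laplace hα hα' hparam ?_ fun θ hθ => ?_
  · rw [ae_map_iff hY (by measurability)]
    exact hM.totalReward_nonneg _ hparam (blockR_nonneg p₁ p₂ p₃)
  · have hRθ : ∀ i, 0 < (blockR p₁ p₂ p₃ *ᵥ θ) i := fun i => by
      rw [blockR_mulVec]
      rcases i with i | i | i
      · exact add_pos (hθ 0) (hθ 1)
      · exact hθ 0
      · exact hθ 1
    obtain ⟨h1, h2⟩ := hM.integral_exp_neg_totalReward (blockR p₁ p₂ p₃) hparam hα hα' hRθ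
    rw [lintegral_map' (measurable_exp_neg_dotProduct θ).aemeasurable hY, ← h2,
      ofReal_integral_eq_lintegral_ofReal h1
        (Filter.Eventually.of_forall fun _ => Real.exp_nonneg _)]

end MPHalpha

theorem mainTheorem6 {p₁ p₂ p₃ : ℕ} (α : ℝ) (hα : 0 < α) (hα' : α ≤ 1)
    (π₁ : Fin p₁ → ℝ) (π₂ : Fin p₂ → ℝ) (π₃ : Fin p₃ → ℝ)
    (T₁₁ : Matrix (Fin p₁) (Fin p₁) ℝ) (T₁₂ : Matrix (Fin p₁) (Fin p₂) ℝ)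
    (T₁₃ : Matrix (Fin p₁) (Fin p₃) ℝ) (T₂₂ : Matrix (Fin p₂) (Fin p₂) ℝ)
    (T₃₃ : Matrix (Fin p₃) (Fin p₃) ℝ)
    (hparam : MPHalpha.IsPHParam (MPHalpha.blockInit π₁ π₂ π₃)
      (MPHalpha.blockT T₁₁ T₁₂ T₁₃ T₂₂ T₃₃)) :
    -- every distribution with the Laplace transform of `MPH*_α(π, T, R)` has the explicit form
    (∀ μ : Measure (Fin 2 → ℝ),
      MPHalpha.IsMPH α (MPHalpha.blockInit π₁ π₂ π₃) (MPHalpha.blockT T₁₁ T₁₂ T₁₃ T₂₂ T₃₃)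
        (MPHalpha.blockR p₁ p₂ p₃) μ →
      MPHalpha.HasExplicitForm α π₁ π₂ π₃ T₁₁ T₁₂ T₁₃ T₂₂ T₃₃ μ) ∧
    -- so does the joint law of the total rewards of every underlying semi-Markov process
    (∀ {Ω : Type*} [MeasurableSpace Ω] (P : Measure Ω)
      (Z : ℕ → Ω → Option (Fin p₁ ⊕ (Fin p₂ ⊕ Fin p₃)))
      (H : ℕ → Fin p₁ ⊕ (Fin p₂ ⊕ Fin p₃) → Ω → ℝ),
      MPHalpha.IsSemiMarkovModel α (MPHalpha.blockInit π₁ π₂ π₃)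
        (MPHalpha.blockT T₁₁ T₁₂ T₁₃ T₂₂ T₃₃) P Z H →
      AEMeasurable (MPHalpha.totalReward (MPHalpha.blockR p₁ p₂ p₃) Z H) P ∧
      MPHalpha.HasExplicitForm α π₁ π₂ π₃ T₁₁ T₁₂ T₁₃ T₂₂ T₃₃
        (P.map (MPHalpha.totalReward (MPHalpha.blockR p₁ p₂ p₃) Z H))) :=
  ⟨fun _ hμ => hμ.hasExplicitForm hα hα' hparam, fun _ _ _ hM =>
    ⟨hM.aemeasurable_totalReward _ hparam, hM.hasExplicitForm hα hα' hparam⟩⟩
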